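/- Let $Q$ be a finite quadrangulation, i.e. a connected simple plane graph all of whose faces (including the outer face) are bounded by $4$-cycles, with its vertices properly coloured black and white. Let $s_0$ be a distinguished black vertex on the outer face and $s_1$ the other black vertex on the outer face. A \emph{strong labeling} of $Q$ is a map from the angles of $Q$ to $\{0,1\}$ such that: (G0) all angles at $s_i$ are labeled $i$ ($i=0,1$); (G1) at every vertex $v\notin\{s_0,s_1\}$ the labels form, in the cyclic order around $v$, a non-empty interval of $0$s and a non-empty interval of $1$s; (G2) for each edge, the two incident labels coincide at one endpoint and differ at the other; (G3) the labels in each face are $0011$ cyclically, and the labels of the outer face, read in clockwise order around the outer cycle starting at $s_0$, are $0011$. A \emph{separating decomposition} of $Q$ is an orientation of the edges together with a partition of them into two directed trees $T_0,T_1$ with sinks $s_0,s_1$ (in $T_i$ every vertex has a directed path to $s_i$) such that the edges at each vertex $v\notin\{s_0,s_1\}$ are gathered as follows, in clockwise order if $v$ is black and in counterclockwise order if $v$ is white: the incoming edges of $T_0$ (if any), the unique outgoing edge of $T_0$, the incoming edges of $T_1$ (if any), the unique outgoing edge of $T_1$. Theorem. Strong labelings and separating decompositions of $Q$ (with respect to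 $s_0,s_1$) are in bijection. More precisely, colour each edge with the common value of the two coinciding labels at one of its endpoints and orient it towards that endpoint; this map sends every strong labeling to a separating decomposition, with $T_i$ the set of edges of colour $i$, and is a bijection from the set of strong labelings of $Q$ onto the set of separating decompositions of $Q$. -/

import Mathlib

/-- A finite connected simple plane graph with at least one edge, up to orientation-preserving
homeomorphism of the plane: a connected simple graph, the clockwise cyclic order of the darts
(edges directed away from a vertex) around every vertex, and a distinguished outer face. That the
surface described by the cyclic orders is the sphere is Euler's formula `euler`.

The faces are the orbits of the permutation which sends a dart `d = (u, v)` to the next dart met when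
one walks along the boundary of a face keeping that face to the right; the successor of `d` is the
dart immediately before `(v, u)` in the clockwise order around `v`. Bounded faces are thus walked
around clockwise. The orbit of `d` is the face to the right of `d`. -/
structure PlaneGraph (V : Type*) where
  graph : SimpleGraph V
  connected : graph.Connected
  /-- the next dart clockwise around the tail of a dart -/
  rot : Equiv.Perm graph.Dart
  rot_fst : ∀ d, (rot d).fst = d.fst
  rot_sameCycle : ∀ d e : graph.Dart, d.fst = e.fst → rot.SameCycle d e
  /-- the next dart along the boundary of the face to the right of a dart -/
  next : Equiv.Perm graph.Dart
  next_eq : ∀ d, next d = rot.symm d.symm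
  /-- `#vertices + #faces = #edges + 2` -/
  euler : Nat.card V + Nat.card (Quotient (Equiv.Perm.SameCycle.setoid next)) =
    Nat.card graph.edgeSet + 2
  outer : Quotient (Equiv.Perm.SameCycle.setoid next)

namespace PlaneGraph

variable {V : Type*}

/-- The directed edges of a plane graph. A dart `d` also stands for an angle: the angle at the tail
of `d` between `d` and the clockwise next dart `rot d`. It is the angle at the tail of `d` on the
right-hand side of `d`, so it belongs to the face to the right of `d`, and the clockwise walk around
that face meets its angles in the order `d, next d, next (next d), …`. The two angles at the tail of
`d` incident to the edge of `d` are `d` (on its right) and `rot.symm d` (on its left). -/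
abbrev Dart (G : PlaneGraph V) : Type _ := G.graph.Dart

/-- The faces, including the outer one. -/
abbrev Face (G : PlaneGraph V) : Type _ := Quotient (Equiv.Perm.SameCycle.setoid G.next)

/-- The face to the right of a dart. -/
def rightFace (G : PlaneGraph V) (d : G.Dart) : G.Face := Quotient.mk _ d

/-- The vertex `v` lies on the face `f`. -/
def OnFace (G : PlaneGraph V) (v : V) (f : G.Face) : Prop :=
  ∃ d : G.Dart, d.fst = v ∧ G.rightFace d = f

end PlaneGraph

/-- A quadrangulation: a plane graph, properly coloured black and white, all of whose faces
(including the outer one) are bounded by a 4-cycle. -/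
structure Quadrangulation (V : Type*) extends PlaneGraph V where
  black : Set V
  bipartite : ∀ u v, graph.Adj u v → (u ∈ black ↔ v ∉ black)
  four_cycle : ∀ d : graph.Dart,
    (next ^ 4) d = d ∧ Function.Injective fun j : Fin 4 => ((next ^ (j : ℕ)) d).fst

/-- `S` is a non-empty interval of a cycle of the permutation `p`: it consists of `k ≥ 1`
successive elements. -/
def IsCyclicInterval {α : Type*} (p : Equiv.Perm α) (S : Set α) : Prop :=
  ∃ a : α, ∃ k : ℕ, 0 < k ∧ S = {x | ∃ j < k, x = (p ^ j) a}

/-- The set `T` of directed edges is a directed tree with sink `s`: the vertices incident to `T`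
together with `s` and the edges of `T` form a tree, and every vertex of this tree has a
directed path in `T` to `s`. -/
def IsDirectedTree {V : Type*} {G : SimpleGraph V} (T : Set G.Dart) (s : V) : Prop :=
  ∃ H : G.Subgraph,
    H.verts = {v | v = s ∨ ∃ d ∈ T, d.fst = v ∨ d.snd = v} ∧
    (∀ u v, H.Adj u v ↔ ∃ d ∈ T, d.edge = s(u, v)) ∧
    H.coe.IsTree ∧
    ∀ v ∈ H.verts, Relation.ReflTransGen (fun u w => ∃ d ∈ T, d.fst = u ∧ d.snd = w) v s

namespace Quadrangulation

variable {V : Type*}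

/-- A strong labeling of the angles with `0` and `1`, for the special vertices `s 0` and `s 1`. -/
@[ext]
structure StrongLabeling (Q : Quadrangulation V) (s : Fin 2 → V) where
  label : Q.Dart → Fin 2
  /-- special vertices: all angles at `s i` are labeled `i` -/
  special : ∀ (i : Fin 2) (d : Q.Dart), d.fst = s i → label d = i
  /-- vertex rule: the labels at every other vertex form a non-empty interval of `0`s and
  a non-empty interval of `1`s -/
  vertex_rule : ∀ v, (∀ i, v ≠ s i) → ∀ i : Fin 2,
    IsCyclicInterval Q.rot {d : Q.Dart | d.fst = v ∧ label d = i}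
  /-- edge rule: the labels incident to an edge coincide at one endpoint and differ at the
  other -/
  edge_rule : ∀ d : Q.Dart,
    Xor (label (Q.rot.symm d) = label d) (label (Q.rot.symm d.symm) = label d.symm)
  /-- face rule: the labels in each face are `0011` cyclically -/
  face_rule : ∀ f : Q.Face, ∃ d : Q.Dart, Q.rightFace d = f ∧
    label d = 0 ∧ label (Q.next d) = 0 ∧
    label ((Q.next ^ 2) d) = 1 ∧ label ((Q.next ^ 3) d) = 1
  /-- the labels of the outer face are `0011` in clockwise order starting at `s 0`. Clockwise means
  clockwise around the outer cycle, so the outer face is to the left, and the walk is backwards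
  along `next`. -/
  outer_rule : ∀ d : Q.Dart, Q.rightFace d = Q.outer → d.fst = s 0 →
    label d = 0 ∧ label (Q.next.symm d) = 0 ∧
    label ((Q.next.symm ^ 2) d) = 1 ∧ label ((Q.next.symm ^ 3) d) = 1

open Classical in
/-- The next dart around the tail of a dart, clockwise around black vertices and counterclockwise
around white vertices, starting at a dart with tail `v`. -/
noncomputable def turn (Q : Quadrangulation V) (v : V) : Equiv.Perm Q.Dart :=
  if v ∈ Q.black then Q.rot else Q.rot.symm

/-- A separating decomposition, for the special vertices `s 0` and `s 1`. The set `T i` consists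
of the edges of the `i`-th tree, with their directions. A dart `e` with tail `v` is the edge of `e`
seen from `v`; this edge is outgoing at `v` in the `i`-th tree if `e ∈ T i`, and incoming if
`e.symm ∈ T i`. -/
@[ext]
structure SeparatingDecomposition (Q : Quadrangulation V) (s : Fin 2 → V) where
  T : Fin 2 → Set Q.Dart
  /-- every edge belongs to exactly one tree, in exactly one direction -/
  partition : ∀ e ∈ Q.graph.edgeSet,
    ∃! p : Fin 2 × Q.Dart, p.2.edge = e ∧ p.2 ∈ T p.1
  tree : ∀ i, IsDirectedTree (T i) (s i)
  /-- turning rule: around every other vertex, in clockwise order at black and counterclockwise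
  order at white vertices, there are the incoming edges of `T 0` (`a ≥ 0` of them), the outgoing
  edge of `T 0`, the incoming edges of `T 1` (`b ≥ 0` of them), the outgoing edge of `T 1`, and
  no further ones -/
  separating : ∀ v, (∀ i, v ≠ s i) → ∃ (e : Q.Dart) (a b : ℕ), e.fst = v ∧
    a + 1 + b + 1 = Nat.card (Q.graph.neighborSet v) ∧
    (∀ j < a, ((Q.turn v ^ j) e).symm ∈ T 0) ∧
    (Q.turn v ^ a) e ∈ T 0 ∧
    (∀ j < b, ((Q.turn v ^ (a + 1 + j)) e).symm ∈ T 1) ∧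
    (Q.turn v ^ (a + 1 + b)) e ∈ T 1

/-- The directed edges of colour `i` induced by a labeling: an edge gets the colour of the two
coincident labels at one of its endpoints, and it is directed towards that endpoint. -/
def inducedEdges (Q : Quadrangulation V) (label : Q.Dart → Fin 2) (i : Fin 2) : Set Q.Dart :=
  {d | label d.symm = i ∧ label (Q.rot.symm d.symm) = i}

end Quadrangulation

/-! Both structures are encoded by a third one, `IsColouring`: an edge 2-colouring in which turning
to the next edge (clockwise at black, counterclockwise at white vertices) keeps the colour at
exactly one end of each edge. That end is the head.

Labelings: an edge takes the label of the angle just before it in the turning direction. At both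
ends this angle lies in the same face, so the colour is well defined iff labels agree along boundary
steps from white to black vertices (`label_next_eq_iff`). In a face `0011` agreements and changes
alternate, and the edge rule relates the two sides of an edge, so this pattern spreads from the
outer face. `angleLabel` is the inverse.

Decompositions: Euler's formula gives 2n - 4 edges, exactly the number leaving ordinary vertices, so
none leaves a special vertex and a decomposition yields a colouring.

The hard converse is the existence of directed paths, `mem_reaching`. Let R be the set of vertices
with a path of colour j to `s j`; edges between R and its complement have the other colour i. By
parity in each face, `turnHead` permutes these cut edges, so each lies on a cycle of it. Each face
has exactly one white dart of colour i, and `turnHead` passes to the neighbouring face across its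
edge. Hence the property of a face that this process ends at `s i` changes only across edges of
colour j; by parity around vertices it does not change across those inside R. It holds for the outer
face, hence for all faces touching R. A cut edge thus both leads to `s i` and lies on a cycle, so
its head is `s i`. As Q without `s i` is connected, R contains every other vertex. -/

theorem Set.Finite.isPeriodicPt_of_subset_image {α : Type*} {N : Set α} (hN : N.Finite) {f : α → α}
    (h : N ⊆ f '' N) {a : α} (ha : a ∈ N) : ∃ n, 0 < n ∧ f^[n] a = a := by
  -- The image is no larger than `N`, so `f` permutes `N`.
  have him : f '' N = N := (Set.eq_of_subset_of_ncard_le h (Set.ncard_image_le hN)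
    (hN.image f)).symm
  have hmaps : Set.MapsTo f N N := fun x hx => him ▸ Set.mem_image_of_mem f hx
  have hinj : Set.InjOn f N := by
    rw [← Set.ncard_image_iff hN, him]
  have := hN.to_subtype
  let g : N → N := hmaps.restrict f N N
  have hg : Function.Injective g := hmaps.restrict_inj.2 hinj
  obtain ⟨n, hn, hp⟩ := Function.mem_periodicPts.1 (hg.mem_periodicPts ⟨a, ha⟩)
  refine ⟨n, hn, ?_⟩
  have h2 : ∀ k, ((g^[k] ⟨a, ha⟩ : N) : α) = f^[k] a := by
    intro k
    induction k with
    | zero => rfl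
    | succ k ih => rw [Function.iterate_succ_apply', Function.iterate_succ_apply', ← ih]; rfl
  rw [← h2, hp]

theorem Equiv.Perm.eq_pow_symm_apply {α : Type*} [Finite α] (p : Equiv.Perm α) (a : α) :
    ∃ n : ℕ, p.symm a = (p ^ n) a := by
  have : p.SameCycle a (p.symm a) := ⟨-1, by simp [Equiv.Perm.inv_def]⟩
  obtain ⟨n, -, h⟩ := this.exists_pow_eq'
  exact ⟨n, h.symm⟩

/-! ### Rotations and face walks in plane graphs -/

namespace PlaneGraph

variable {V : Type*} (G : PlaneGraph V)

@[simp] theorem rot_next (d : G.Dart) : G.rot (G.next d) = d.symm := by simp [G.next_eq]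

@[simp] theorem next_symm_eq (d : G.Dart) : G.next d.symm = G.rot.symm d := by
  simp [G.next_eq]

theorem nextSymm_eq (d : G.Dart) : G.next.symm d = (G.rot d).symm := by
  rw [Equiv.symm_apply_eq]; simp

theorem rot_symm_fst (d : G.Dart) : (G.rot.symm d).fst = d.fst := by
  rw [← G.rot_fst (G.rot.symm d), Equiv.apply_symm_apply]

@[simp] theorem next_fst (d : G.Dart) : (G.next d).fst = d.snd := by
  rw [← G.rot_fst, rot_next]; rfl

theorem rightFace_eq_iff {d e : G.Dart} : G.rightFace d = G.rightFace e ↔ G.next.SameCycle d e :=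
  Quotient.eq (r := Equiv.Perm.SameCycle.setoid G.next)

theorem rot_pow_fst (d : G.Dart) (n : ℕ) : ((G.rot ^ n) d).fst = d.fst := by
  induction n with
  | zero => rfl
  | succ n ih => rw [pow_succ', Equiv.Perm.mul_apply, G.rot_fst, ih]

/-- A property of the angles which changes across one edge at a vertex changes across another
one. -/
theorem exists_change_of_change [Finite V] (y : G.Dart → Prop) {o : G.Dart}
    (h : ¬ (y (G.rot.symm o) ↔ y o)) :
    ∃ x, x.fst = o.fst ∧ x ≠ o ∧ ¬ (y (G.rot.symm x) ↔ y x) := by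
  have : Finite G.Dart := Finite.of_injective _ SimpleGraph.Dart.toProd_injective
  by_contra! hc
  have key : ∀ k : ℕ, y ((G.rot ^ k) o) ↔ y o := by
    intro k
    induction k with
    | zero => rfl
    | succ k ih =>
      by_cases hx : (G.rot ^ (k + 1)) o = o
      · rw [hx]
      · rw [← hc _ (G.rot_pow_fst o _) hx, ← ih, pow_succ', Equiv.Perm.mul_apply,
          Equiv.symm_apply_apply]
  obtain ⟨n, hn⟩ := G.rot.eq_pow_symm_apply o
  exact h (hn ▸ key n)

theorem rot_induction [Finite V] {P : G.Dart → Prop} {d e : G.Dart} (hde : d.fst = e.fst)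
    (h : ∀ x, x.fst = d.fst → P x → P (G.rot x)) (hd : P d) : P e := by
  have : Finite G.Dart := Finite.of_injective _ SimpleGraph.Dart.toProd_injective
  obtain ⟨n, -, rfl⟩ := (G.rot_sameCycle d e hde).exists_pow_eq'
  clear hde
  induction n with
  | zero => exact hd
  | succ n ih =>
    rw [pow_succ', Equiv.Perm.mul_apply]
    exact h _ (G.rot_pow_fst d n) ih

theorem card_darts_at (v : V) :
    Nat.card {d : G.Dart // d.fst = v} = Nat.card (G.graph.neighborSet v) :=
  Nat.card_congr
    { toFun := fun d => ⟨d.1.snd, by have := d.1.adj; rw [d.2] at this; exact this⟩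
      invFun := fun w => ⟨⟨(v, w.1), w.2⟩, rfl⟩
      left_inv := by rintro ⟨⟨⟨a, b⟩, h⟩, rfl⟩; rfl
      right_inv := fun _ => rfl }

end PlaneGraph

/-! ### Quadrilateral faces, Euler's count, turning around a vertex -/

namespace Quadrangulation

variable {V : Type*} (Q : Quadrangulation V)

theorem finite_dart [Finite V] : Finite Q.Dart :=
  Finite.of_injective _ SimpleGraph.Dart.toProd_injective

theorem fst_mem_black_iff (d : Q.Dart) : d.fst ∈ Q.black ↔ d.snd ∉ Q.black :=
  Q.bipartite _ _ d.adj

theorem next_fst_mem_black_iff (d : Q.Dart) : (Q.next d).fst ∈ Q.black ↔ d.fst ∉ Q.black := by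
  rw [Q.next_fst, Q.fst_mem_black_iff, not_not]

theorem next_next_next_next (d : Q.Dart) : Q.next (Q.next (Q.next (Q.next d))) = d :=
  (Q.four_cycle d).1

theorem rot_eq_symm_next (d : Q.Dart) : Q.rot d = (Q.next (Q.next (Q.next d))).symm := by
  rw [← Q.rot_next, Q.next_next_next_next]

theorem fst_ne_next_next_fst (d : Q.Dart) : d.fst ≠ (Q.next (Q.next d)).fst := fun h => by
  have := (Q.four_cycle d).2 (a₁ := 0) (a₂ := 2) h
  simp at this

theorem eq_of_sameCycle_next {d e : Q.Dart} (h : Q.next.SameCycle d e) :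
    ∃ k : Fin 4, (Q.next ^ (k : ℕ)) d = e := by
  obtain ⟨z, hz⟩ := h
  have h4 : (Q.next ^ 4) = 1 := Equiv.ext fun d => (Q.four_cycle d).1
  refine ⟨⟨(z % 4).toNat, by omega⟩, ?_⟩
  have h1 : (Q.next ^ ((z % 4).toNat)) = Q.next ^ z := by
    rw [← zpow_natCast, Int.toNat_of_nonneg (by omega)]
    conv_rhs => rw [← Int.emod_add_mul_ediv z 4, zpow_add, zpow_mul]
    rw [show Q.next ^ (4 : ℤ) = 1 from h4]
    simp
  simpa [h1] using hz

/-- The darts of a face. -/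
theorem rightFace_eq_cases {d e : Q.Dart} (h : Q.rightFace d = Q.rightFace e) :
    e = d ∨ e = Q.next d ∨ e = Q.next (Q.next d) ∨ e = Q.next (Q.next (Q.next d)) := by
  obtain ⟨k, rfl⟩ := Q.eq_of_sameCycle_next (Q.rightFace_eq_iff.1 h)
  fin_cases k
  · left; rfl
  · right; left; rfl
  · right; right; left; rfl
  · right; right; right; rfl

theorem rightFace_next (d : Q.Dart) : Q.rightFace (Q.next d) = Q.rightFace d :=
  Q.rightFace_eq_iff.2 (Equiv.Perm.sameCycle_apply_left.2 (Equiv.Perm.SameCycle.refl _ _))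

theorem card_dart [Finite V] : Nat.card Q.Dart = 4 * Nat.card Q.Face := by
  have hf : Function.Bijective
      (fun x : Fin 4 × Q.Face => (Q.next ^ (x.1 : ℕ)) (Quotient.out x.2)) := by
    constructor
    · rintro ⟨k, f⟩ ⟨l, g⟩ h
      have hfg : f = g := by
        rw [← Quotient.out_eq f, ← Quotient.out_eq g]
        apply Quotient.sound
        change Q.next.SameCycle _ _
        have h1 : Q.next.SameCycle ((Q.next ^ (k : ℕ)) f.out) ((Q.next ^ (l : ℕ)) g.out) := by
          change (Q.next ^ (k : ℕ)) f.out = (Q.next ^ (l : ℕ)) g.out at h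
          rw [h]
        simpa using h1
      subst hfg
      have := (Q.four_cycle f.out).2 (congrArg (fun d : Q.Dart => d.fst) h)
      rw [show k = l from this]
    · intro d
      obtain ⟨k, hk⟩ := Q.eq_of_sameCycle_next
        (Q.rightFace_eq_iff.1 (Quotient.out_eq (Q.rightFace d)))
      exact ⟨⟨k, _⟩, hk⟩
  rw [← Nat.card_congr (Equiv.ofBijective _ hf), Nat.card_prod, Nat.card_fin]

/-- A face has four darts and an edge two, so there are twice as many edges as faces; substitute in
Euler's formula. -/
theorem card_edgeSet [Finite V] : Nat.card Q.graph.edgeSet + 4 = 2 * Nat.card V := by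
  classical
  have := Fintype.ofFinite V
  have h1 := Q.card_dart
  have h2 := Q.euler
  have h3 : Nat.card Q.Dart = 2 * Nat.card Q.graph.edgeSet := by
    have := Q.graph.dart_card_eq_twice_card_edges
    rw [Nat.card_eq_fintype_card, this, Nat.card_coe_set_eq, ← SimpleGraph.coe_edgeFinset,
      Set.ncard_coe_finset]
  change _ + Nat.card Q.Face = _ at h2
  omega

theorem turn_black {v : V} (h : v ∈ Q.black) : Q.turn v = Q.rot := if_pos h

theorem turn_white {v : V} (h : v ∉ Q.black) : Q.turn v = Q.rot.symm := if_neg h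

theorem turn_fst (v : V) (d : Q.Dart) : (Q.turn v d).fst = d.fst := by
  by_cases h : v ∈ Q.black
  · rw [Q.turn_black h, Q.rot_fst]
  · rw [Q.turn_white h, Q.rot_symm_fst]

theorem turn_pow_fst (v : V) (d : Q.Dart) (n : ℕ) : ((Q.turn v ^ n) d).fst = d.fst := by
  induction n with
  | zero => rfl
  | succ n ih => rw [pow_succ', Equiv.Perm.mul_apply, Q.turn_fst, ih]

theorem turn_sameCycle (v : V) {d e : Q.Dart} (h : d.fst = e.fst) :
    (Q.turn v).SameCycle d e := by
  by_cases hv : v ∈ Q.black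
  · rw [Q.turn_black hv]; exact Q.rot_sameCycle d e h
  · rw [Q.turn_white hv]; exact Equiv.Perm.sameCycle_inv.2 (Q.rot_sameCycle d e h)

/-- A rotation around a vertex enumerates the darts at this vertex. -/
theorem turn_enum [Finite V] (u : V) (e : Q.Dart) :
    0 < Nat.card (Q.graph.neighborSet e.fst) ∧
    (Q.turn u ^ Nat.card (Q.graph.neighborSet e.fst)) e = e ∧
    (∀ d : Q.Dart, d.fst = e.fst → ∃ j < Nat.card (Q.graph.neighborSet e.fst),
      d = (Q.turn u ^ j) e) ∧
    ∀ j < Nat.card (Q.graph.neighborSet e.fst), ∀ k < Nat.card (Q.graph.neighborSet e.fst),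
      (Q.turn u ^ j) e = (Q.turn u ^ k) e → j = k := by
  have := Q.finite_dart
  set p := Q.turn u with hp
  set m := Function.minimalPeriod p e with hm
  have hmem : e ∈ Function.periodicPts p := p.injective.mem_periodicPts e
  have hpos : 0 < m := Function.minimalPeriod_pos_of_mem_periodicPts hmem
  have hpow : ∀ k, (p ^ k) e = p^[k] e := fun k => by rw [Equiv.Perm.iterate_eq_pow]
  have hsurj : ∀ d : Q.Dart, d.fst = e.fst → ∃ j < m, d = (p ^ j) e := by
    intro d hd
    obtain ⟨k, -, rfl⟩ := (Q.turn_sameCycle u hd.symm).exists_pow_eq'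
    refine ⟨k % m, Nat.mod_lt _ hpos, ?_⟩
    rw [hpow, hpow, Function.iterate_mod_minimalPeriod_eq]
  have hinj : ∀ j < m, ∀ k < m, (p ^ j) e = (p ^ k) e → j = k := by
    intro j hj k hk h
    rw [hpow, hpow] at h
    exact (Function.iterate_eq_iterate_iff_of_lt_minimalPeriod hj hk).1 h
  have hcard : m = Nat.card (Q.graph.neighborSet e.fst) := by
    rw [← Q.card_darts_at]
    have hb : Function.Bijective (fun k : Fin m => (⟨(p ^ (k : ℕ)) e, Q.turn_pow_fst u e k⟩ :
        {d : Q.Dart // d.fst = e.fst})) := by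
      constructor
      · intro k l h
        exact Fin.ext (hinj k k.2 l l.2 (congrArg Subtype.val h))
      · rintro ⟨d, hd⟩
        obtain ⟨j, hj, h⟩ := hsurj d hd
        exact ⟨⟨j, hj⟩, Subtype.ext h.symm⟩
    rw [← Nat.card_congr (Equiv.ofBijective _ hb), Nat.card_fin]
  rw [← hcard]
  refine ⟨hpos, ?_, hsurj, hinj⟩
  rw [hpow]
  exact Function.iterate_minimalPeriod

end Quadrangulation

/-- A cycle that enters an invariant set never leaves it, so it lies there entirely. It is applied
to sinks: a cycle reaching a sink was there all along. -/
theorem Function.mem_of_isPeriodicPt_of_iterate_mem {α : Type*} {f : α → α} {Z : Set α}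
    (hZ : Set.MapsTo f Z Z) {a : α} {n : ℕ} (hn : 0 < n) (ha : f^[n] a = a) {m : ℕ}
    (hm : f^[m] a ∈ Z) : a ∈ Z := by
  have h1 : f^[n * m] a = a := (Function.IsPeriodicPt.mul_const ha m)
  have h2 : f^[n * m] a ∈ Z := by
    rw [show n * m = (n * m - m) + m from
      (Nat.sub_add_cancel (Nat.le_mul_of_pos_left m hn)).symm, Function.iterate_add_apply]
    exact hZ.iterate _ hm
  rwa [h1] at h2

theorem Fin.eq_of_ne_of_ne_two {a b c : Fin 2} (h : a ≠ b) (h' : c ≠ b) : a = c := by omega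

/-! ### Edge colourings and the orientation they induce -/

namespace Quadrangulation

variable {V : Type*} (Q : Quadrangulation V)

/-- The next dart around the tail of a dart, clockwise at black and counterclockwise at white
vertices. -/
noncomputable def turnDart (d : Q.Dart) : Q.Dart := Q.turn d.fst d

variable {Q}

theorem turnDart_fst (d : Q.Dart) : (Q.turnDart d).fst = d.fst := Q.turn_fst _ _

theorem turnDart_black {d : Q.Dart} (h : d.fst ∈ Q.black) : Q.turnDart d = Q.rot d := by
  rw [turnDart, Q.turn_black h]

theorem turnDart_white {d : Q.Dart} (h : d.fst ∉ Q.black) : Q.turnDart d = Q.rot.symm d := by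
  rw [turnDart, Q.turn_white h]

theorem turn_pow_succ {e : Q.Dart} {v : V} (h : e.fst = v) (j : ℕ) :
    (Q.turn v ^ (j + 1)) e = Q.turnDart ((Q.turn v ^ j) e) := by
  rw [pow_succ', Equiv.Perm.mul_apply, turnDart, Q.turn_pow_fst, h]

theorem symm_fst_mem_black_iff (d : Q.Dart) : d.symm.fst ∈ Q.black ↔ d.fst ∉ Q.black := by
  rw [Q.fst_mem_black_iff d.symm]; rfl

theorem turnDart_next {d : Q.Dart} (h : d.fst ∉ Q.black) : Q.turnDart (Q.next d) = d.symm := by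
  rw [turnDart_black ((Q.next_fst_mem_black_iff d).2 h), Q.rot_next]

theorem turnDart_symm_black {d : Q.Dart} (h : d.fst ∈ Q.black) :
    Q.turnDart d.symm = Q.next d := by
  rw [turnDart_white (by rw [symm_fst_mem_black_iff]; exact not_not.2 h), ← Q.next_symm_eq,
    SimpleGraph.Dart.symm_symm]

/-- Edge colourings of a quadrangulation with the local properties of the colourings which come from
strong labelings and from separating decompositions. An edge is directed towards the endpoint
around which the colour does not change when turning from this edge to the next one. -/
structure IsColouring (Q : Quadrangulation V) (s : Fin 2 → V) (c : Q.Dart → Fin 2) : Prop where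
  symm : ∀ d, c d.symm = c d
  edge : ∀ d, c (Q.turnDart d) = c d ↔ c (Q.turnDart d.symm) ≠ c d
  special : ∀ (i : Fin 2) (d : Q.Dart), d.fst = s i → c d = i
  vertex : ∀ v, (∀ i, v ≠ s i) → ∃ (e : Q.Dart) (a b : ℕ), e.fst = v ∧
    a + 1 + b + 1 = Nat.card (Q.graph.neighborSet v) ∧
    (∀ j ≤ a, c ((Q.turn v ^ j) e) = 0) ∧ (∀ j ≤ b, c ((Q.turn v ^ (a + 1 + j)) e) = 1)

/-- The directed edges of colour `i`. -/
def directedEdges (c : Q.Dart → Fin 2) (i : Fin 2) : Set Q.Dart :=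
  {d | c d = i ∧ c (Q.turnDart d.symm) = i}

open Classical in
/-- The dart of the edge of `d` whose tail is the head of the directed edge. -/
noncomputable def inDart (c : Q.Dart → Fin 2) (d : Q.Dart) : Q.Dart :=
  if c (Q.turnDart d) = c d then d else d.symm

/-- Turn from the dart `d` to the next one around its tail, and represent the edge of this dart by the
dart at its head. -/
noncomputable def turnHead (c : Q.Dart → Fin 2) (d : Q.Dart) : Q.Dart :=
  inDart c (Q.turnDart d)

/-- The darts from which iterated turning around heads leads to edges at the vertex `v`. -/
def TurnsTo (c : Q.Dart → Fin 2) (v : V) (d : Q.Dart) : Prop :=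
  ∃ m, ((turnHead c)^[m] d).fst = v

/-- The white dart of colour `i` of the face to the right of `d` leads to edges at `v`. -/
def FaceTurnsTo (c : Q.Dart → Fin 2) (i : Fin 2) (v : V) (d : Q.Dart) : Prop :=
  ∃ w : Q.Dart, Q.rightFace d = Q.rightFace w ∧ w.fst ∉ Q.black ∧ c w = i ∧
    TurnsTo c v (inDart c w)

/-- The vertices with a directed path to `v` in colour `i`. -/
def reaching (c : Q.Dart → Fin 2) (i : Fin 2) (v : V) : Set V :=
  {u | Relation.ReflTransGen (fun u w => ∃ d ∈ directedEdges c i, d.fst = u ∧ d.snd = w) u v}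

open Classical in
/-- The head of the edge of colour `i` leaving `v`, or `v` if there is none. -/
noncomputable def parent (c : Q.Dart → Fin 2) (i : Fin 2) (v : V) : V :=
  if h : ∃ d ∈ directedEdges c i, d.fst = v then h.choose.snd else v

variable {s : Fin 2 → V} {c : Q.Dart → Fin 2}

theorem inDart_of_eq {d : Q.Dart} (h : c (Q.turnDart d) = c d) : inDart c d = d := if_pos h

theorem inDart_of_ne {d : Q.Dart} (h : c (Q.turnDart d) ≠ c d) : inDart c d = d.symm := if_neg h

theorem faceTurnsTo_congr {i : Fin 2} {v : V} {d e : Q.Dart} (h : Q.rightFace d = Q.rightFace e) :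
    FaceTurnsTo c i v d ↔ FaceTurnsTo c i v e := by
  rw [FaceTurnsTo, FaceTurnsTo, h]

namespace IsColouring

variable (hc : Q.IsColouring s c)
include hc

theorem mem_directedEdges {d : Q.Dart} {i : Fin 2} :
    d ∈ directedEdges c i ↔ c d = i ∧ c (Q.turnDart d) ≠ i := by
  refine and_congr_right fun h => ?_
  have := hc.edge d
  rw [h] at this
  tauto

theorem symm_mem_directedEdges {d : Q.Dart} {i : Fin 2} :
    d.symm ∈ directedEdges c i ↔ c d = i ∧ c (Q.turnDart d) = i := by
  change c d.symm = i ∧ c (Q.turnDart d.symm.symm) = i ↔ _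
  rw [hc.symm, SimpleGraph.Dart.symm_symm]

theorem mem_or_symm_mem {d : Q.Dart} {i : Fin 2} (h : c d = i) :
    d ∈ directedEdges c i ∨ d.symm ∈ directedEdges c i := by
  rw [hc.mem_directedEdges, hc.symm_mem_directedEdges]
  tauto

/-- An edge leaves a vertex where the colour changes after it, and around `s k` the colour is
constant. -/
theorem fst_ne_of_mem {d : Q.Dart} {i : Fin 2} (h : d ∈ directedEdges c i) (k : Fin 2) :
    d.fst ≠ s k := by
  intro hk
  rw [hc.mem_directedEdges, hc.special k d hk, hc.special k _ ((turnDart_fst d).trans hk)] at h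
  exact h.2 h.1

/-- The last edge of the run of colour `i` leaves `v`. For colour `1` the edge after it is again the
first dart `e`, of colour `0`. -/
theorem exists_out [Finite V] {v : V} (hv : ∀ i, v ≠ s i) (i : Fin 2) :
    ∃ d ∈ directedEdges c i, d.fst = v := by
  obtain ⟨e, a, b, rfl, hn, h0, h1⟩ := hc.vertex v hv
  obtain ⟨-, hper, -, -⟩ := Q.turn_enum e.fst e
  rw [← hn, turn_pow_succ rfl] at hper
  rcases Fin.exists_fin_two.1 ⟨i, rfl⟩ with hi | hi
  · refine ⟨(Q.turn e.fst ^ a) e, hc.mem_directedEdges.2 ⟨?_, ?_⟩, Q.turn_pow_fst _ _ _⟩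
    · rw [h0 a le_rfl, hi]
    · rw [← turn_pow_succ rfl, hi, show a + 1 = a + 1 + 0 from rfl, h1 0 (Nat.zero_le _)]
      decide
  · refine ⟨(Q.turn e.fst ^ (a + 1 + b)) e, hc.mem_directedEdges.2 ⟨?_, ?_⟩, Q.turn_pow_fst _ _ _⟩
    · rw [h1 b le_rfl, hi]
    · have h2 := h0 0 (Nat.zero_le _)
      rw [pow_zero, Equiv.Perm.one_apply] at h2
      rw [hper, hi, h2]
      decide

theorem eq_of_mem_of_fst_eq [Finite V] {d e : Q.Dart} {i : Fin 2} (hd : d ∈ directedEdges c i)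
    (he : e ∈ directedEdges c i) (h : d.fst = e.fst) : d = e := by
  obtain ⟨x, a, b, hx, hn, h0, h1⟩ := hc.vertex d.fst (hc.fst_ne_of_mem hd)
  have key : ∀ y ∈ directedEdges c i, y.fst = d.fst →
      y = (Q.turn d.fst ^ (if i = 0 then a else a + 1 + b)) x := by
    intro y hy hyd
    obtain ⟨-, -, hsurj, -⟩ := Q.turn_enum d.fst x
    obtain ⟨j, hj, rfl⟩ := hsurj y (hyd.trans hx.symm)
    rw [hx, ← hn] at hj
    rw [hc.mem_directedEdges, ← turn_pow_succ hx] at hy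
    rcases lt_trichotomy j a with hja | rfl | hja
    · rw [h0 j hja.le, h0 (j + 1) hja] at hy
      exact absurd hy.1 hy.2
    · rw [if_pos (by rw [← hy.1, h0 j le_rfl])]
    · obtain ⟨k, rfl⟩ := Nat.exists_eq_add_of_lt hja
      rw [show a + k + 1 = a + 1 + k by ring] at hy hj ⊢
      rw [h1 k (by omega)] at hy
      rw [if_neg (by rw [← hy.1]; decide)]
      rcases (show k ≤ b by omega).eq_or_lt with rfl | hk
      · rfl
      · rw [add_assoc, h1 (k + 1) hk] at hy
        exact absurd hy.1 hy.2
  rw [key d hd rfl, key e he h.symm]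

theorem inDart_symm (d : Q.Dart) : inDart c d.symm = inDart c d := by
  have h := hc.edge d
  by_cases h1 : c (Q.turnDart d) = c d
  · rw [inDart_of_eq h1, inDart_of_ne, SimpleGraph.Dart.symm_symm]
    rw [hc.symm]; exact h.1 h1
  · rw [inDart_of_ne h1, inDart_of_eq]
    rw [hc.symm]; tauto

/-! ### Turning around heads as a walk through the faces -/

theorem turnHead_fst_of_special {i : Fin 2} {d : Q.Dart} (h : d.fst = s i) :
    (turnHead c d).fst = s i := by
  have h1 : (Q.turnDart d).fst = s i := (turnDart_fst d).trans h
  rw [turnHead, inDart_of_eq, h1]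
  rw [hc.special i _ h1, hc.special i _ ((turnDart_fst _).trans h1)]

theorem turnsTo_turnHead_iff {i : Fin 2} {d : Q.Dart} :
    TurnsTo c (s i) (turnHead c d) ↔ TurnsTo c (s i) d := by
  constructor
  · rintro ⟨m, hm⟩
    exact ⟨m + 1, hm⟩
  · rintro ⟨m, hm⟩
    refine ⟨m, ?_⟩
    rw [← Function.iterate_succ_apply, Function.iterate_succ_apply']
    exact hc.turnHead_fst_of_special hm

/-- The two white darts of a face have different colours. -/
theorem next_next_ne {d : Q.Dart} (h : d.fst ∉ Q.black) : c (Q.next (Q.next d)) ≠ c d := by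
  have hb : (Q.next d).fst ∈ Q.black := (Q.next_fst_mem_black_iff d).2 h
  have := hc.edge (Q.next d)
  rw [turnDart_next h, turnDart_symm_black hb, hc.symm] at this
  intro h2
  rw [h2] at this
  tauto

/-- By `next_next_ne`, `d` is the only white dart of colour `i` in its face. -/
theorem faceTurnsTo_iff_of_white {i : Fin 2} {v : V} {d : Q.Dart} (h : d.fst ∉ Q.black)
    (hi : c d = i) : FaceTurnsTo c i v d ↔ TurnsTo c v (inDart c d) := by
  constructor
  · rintro ⟨w, hw, hwb, hwi, hwt⟩
    rcases Q.rightFace_eq_cases hw with rfl | rfl | rfl | rfl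
    · exact hwt
    · rw [Q.next_fst_mem_black_iff] at hwb
      exact absurd h hwb
    · exact absurd (hwi.trans hi.symm) (hc.next_next_ne h)
    · simp only [Q.next_fst_mem_black_iff] at hwb
      tauto
  · exact fun ht => ⟨d, rfl, h, hi, ht⟩

/-- On the right of `d` the white dart of colour `i` is `d` itself; on the left it is the white dart
of the edge obtained by turning at the head of `d`. These are consecutive under `turnHead`, so one
leads to `s i` iff the other does. -/
theorem faceTurnsTo_symm_of_white {i : Fin 2} {d : Q.Dart} (h : d.fst ∉ Q.black)
    (hi : c d = i) : FaceTurnsTo c i (s i) d.symm ↔ FaceTurnsTo c i (s i) d := by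
  have hb : d.symm.fst ∈ Q.black := (symm_fst_mem_black_iff d).2 h
  rw [hc.faceTurnsTo_iff_of_white h hi]
  by_cases h1 : c (Q.turnDart d) = c d
  · rw [inDart_of_eq h1, ← hc.turnsTo_turnHead_iff,
      ← faceTurnsTo_congr (Q.rightFace_next d.symm), Q.next_symm_eq, ← turnDart_white h,
      hc.faceTurnsTo_iff_of_white (by rwa [turnDart_fst]) (h1.trans hi), turnHead]
  · have h2 : c (Q.turnDart d.symm) = c d := by have := hc.edge d; tauto
    rw [inDart_of_ne h1, ← hc.turnsTo_turnHead_iff, turnHead, ← hc.inDart_symm,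
      turnDart_black hb, ← Q.nextSymm_eq, ← hc.faceTurnsTo_iff_of_white (i := i)]
    · apply faceTurnsTo_congr
      rw [← Q.rightFace_next (Q.next.symm d.symm), Equiv.apply_symm_apply]
    · rw [← Q.next_fst_mem_black_iff, Equiv.apply_symm_apply]
      exact hb
    · rw [Q.nextSymm_eq, hc.symm, ← turnDart_black hb, h2, hi]

theorem faceTurnsTo_symm {i : Fin 2} {d : Q.Dart} (hi : c d = i) :
    FaceTurnsTo c i (s i) d.symm ↔ FaceTurnsTo c i (s i) d := by
  by_cases h : d.fst ∈ Q.black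
  · rw [← hc.faceTurnsTo_symm_of_white (d := d.symm) _ (by rw [hc.symm, hi]),
      SimpleGraph.Dart.symm_symm]
    rw [symm_fst_mem_black_iff]; exact not_not.2 h
  · exact hc.faceTurnsTo_symm_of_white h hi

/-! ### Directed paths to the sinks -/

theorem parent_fst [Finite V] {d : Q.Dart} {i : Fin 2} (h : d ∈ directedEdges c i) :
    parent c i d.fst = d.snd := by
  have hex : ∃ e ∈ directedEdges c i, e.fst = d.fst := ⟨d, h, rfl⟩
  rw [parent, dif_pos hex, hc.eq_of_mem_of_fst_eq hex.choose_spec.1 h hex.choose_spec.2]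

theorem parent_special (i k : Fin 2) : parent c i (s k) = s k :=
  dif_neg fun ⟨_, hd, hk⟩ => hc.fst_ne_of_mem hd k hk

theorem exists_iterate_parent [Finite V] {i : Fin 2} {u v : V} (h : u ∈ reaching c i v) :
    ∃ n, (parent c i)^[n] u = v := by
  induction h using Relation.ReflTransGen.head_induction_on with
  | refl => exact ⟨0, rfl⟩
  | head h _ ih =>
    obtain ⟨d, hd, rfl, rfl⟩ := h
    obtain ⟨n, hn⟩ := ih
    exact ⟨n + 1, by rw [Function.iterate_succ_apply, hc.parent_fst hd, hn]⟩

/-- Out-edges of a given colour are unique, so a path from the tail must begin with `d`. -/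
theorem fst_mem_reaching_iff [Finite V] {d : Q.Dart} {j : Fin 2} (h : d ∈ directedEdges c j) :
    d.fst ∈ reaching c j (s j) ↔ d.snd ∈ reaching c j (s j) := by
  constructor
  · intro hd
    rcases Relation.ReflTransGen.cases_head hd with heq | ⟨w, ⟨e, he, hef, rfl⟩, hw⟩
    · exact absurd heq (hc.fst_ne_of_mem h j)
    · rwa [hc.eq_of_mem_of_fst_eq h he hef.symm]
  · exact fun hd => Relation.ReflTransGen.head ⟨d, h, rfl, rfl⟩ hd

theorem mem_reaching_iff [Finite V] {d : Q.Dart} {j : Fin 2} (h : c d = j) :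
    d.fst ∈ reaching c j (s j) ↔ d.snd ∈ reaching c j (s j) := by
  rcases hc.mem_or_symm_mem h with h | h
  · exact hc.fst_mem_reaching_iff h
  · exact (hc.fst_mem_reaching_iff h).symm

theorem eq_special_of_periodic [Finite V] {j : Fin 2} {v : V} (hv : v ∈ reaching c j (s j))
    {n : ℕ} (hn : 0 < n) (h : (parent c j)^[n] v = v) : v = s j := by
  obtain ⟨m, hm⟩ := hc.exists_iterate_parent hv
  refine Function.mem_of_isPeriodicPt_of_iterate_mem (Z := {s j}) ?_ hn h hm
  rintro _ rfl
  exact hc.parent_special j j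

/-- No property of the faces which changes only across edges of colour `j` changes across an edge of
the component of `s j`. -/
theorem iff_of_mem_reaching [Finite V] {j : Fin 2} (y : Q.Dart → Prop)
    (hnext : ∀ d, y (Q.next d) ↔ y d) (hy : ∀ d, c d ≠ j → (y d.symm ↔ y d))
    {d : Q.Dart} (hd : d ∈ directedEdges c j) (hv : d.fst ∈ reaching c j (s j)) :
    y d.symm ↔ y d := by
  by_contra hne
  -- If `y` changes across the out-edge of `v`, it changes across a second edge at `v`. That edge
  -- has colour `j` and must be incoming, so its tail is in `N` with parent `v`. Hence `N` consists
  -- of cycles of `parent`, which cannot meet the component of the sink.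
  let N : Set V := {v | ∃ d ∈ directedEdges c j, d.fst = v ∧ ¬ (y d.symm ↔ y d)}
  have hN : N ⊆ parent c j '' N := by
    rintro _ ⟨o, ho, rfl, hoy⟩
    rw [← hnext, Q.next_symm_eq] at hoy
    obtain ⟨x, hx, hxo, hxy⟩ := Q.exists_change_of_change y hoy
    rw [← Q.next_symm_eq, hnext] at hxy
    have hcx : c x = j := by
      by_contra hcx
      exact hxy (hy x hcx)
    have hxs : x.symm ∈ directedEdges c j := by
      refine (hc.mem_or_symm_mem hcx).resolve_left fun h => hxo ?_
      exact hc.eq_of_mem_of_fst_eq h ho hx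
    refine ⟨x.snd, ⟨x.symm, hxs, rfl, ?_⟩, (hc.parent_fst hxs).trans hx⟩
    rw [SimpleGraph.Dart.symm_symm]
    tauto
  obtain ⟨n, hn, hp⟩ := N.toFinite.isPeriodicPt_of_subset_image hN ⟨d, hd, rfl, hne⟩
  exact hc.fst_ne_of_mem hd j (hc.eq_special_of_periodic hv hn hp)

theorem iff_at_of_mem_reaching [Finite V] {j : Fin 2} (y : Q.Dart → Prop)
    (hnext : ∀ d, y (Q.next d) ↔ y d) (hy : ∀ d, c d ≠ j → (y d.symm ↔ y d))
    {d e : Q.Dart} (hv : d.fst ∈ reaching c j (s j)) (hde : d.fst = e.fst) (hd : y d) : y e := by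
  refine Q.rot_induction (P := y) hde (fun x hx hyx => ?_) hd
  have h1 : y (Q.rot x).symm := by
    rw [← hnext, Q.next_symm_eq, Equiv.symm_apply_apply]; exact hyx
  have hrx : (Q.rot x).fst ∈ reaching c j (s j) := by rwa [Q.rot_fst, hx]
  by_cases hcx : c (Q.rot x) = j
  · rcases hc.mem_or_symm_mem hcx with h | h
    · exact (hc.iff_of_mem_reaching y hnext hy h hrx).1 h1
    · have := hc.iff_of_mem_reaching y hnext hy h ((hc.mem_reaching_iff hcx).1 hrx)
      rw [SimpleGraph.Dart.symm_symm] at this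
      exact this.2 h1
  · exact (hy _ hcx).1 h1

theorem forall_of_mem_reaching [Finite V] {j : Fin 2} (y : Q.Dart → Prop)
    (hnext : ∀ d, y (Q.next d) ↔ y d) (hy : ∀ d, c d ≠ j → (y d.symm ↔ y d))
    {e : Q.Dart} (he : e.fst = s j) (hye : y e) {v : V} (hv : v ∈ reaching c j (s j)) :
    ∀ d : Q.Dart, d.fst = v → y d := by
  induction hv using Relation.ReflTransGen.head_induction_on with
  | refl =>
    intro d hd
    exact hc.iff_at_of_mem_reaching y hnext hy (he ▸ Relation.ReflTransGen.refl)
      (he.trans hd.symm) hye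
  | head h hw ih =>
    obtain ⟨o, ho, rfl, rfl⟩ := h
    intro d hd
    have hr : o.fst ∈ reaching c j (s j) := (hc.fst_mem_reaching_iff ho).2 hw
    exact hc.iff_at_of_mem_reaching y hnext hy hr hd.symm
      ((hc.iff_of_mem_reaching y hnext hy ho hr).1 (ih o.symm rfl))

/-- The edges of colour `i` across which a property of the vertices changes which changes only
across edges of colour `i` lie on cycles of `turnHead`. -/
theorem periodic_of_change [Finite V] {i : Fin 2} (p : V → Prop)
    (hp : ∀ d : Q.Dart, c d ≠ i → (p d.fst ↔ p d.snd)) {d : Q.Dart}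
    (hd : ¬ (p d.fst ↔ p d.snd)) :
    ∃ n, 0 < n ∧ (turnHead c)^[n] (inDart c d) = inDart c d := by
  have := Q.finite_dart
  let N : Set Q.Dart := {x | ∃ d : Q.Dart, d.fst ∉ Q.black ∧ x = inDart c d ∧
    ¬ (p d.fst ↔ p d.snd)}
  -- Around a face `p` changes an even number of times. With a change at `d` and none at the
  -- opposite edge `d2`, which has the other colour, exactly one of `d1`, `d3` changes. It has
  -- colour `i` too, and turning from it leads to `d`.
  have hN : N ⊆ turnHead c '' N := by
    rintro _ ⟨d, hdb, rfl, hdp⟩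
    have hdi : c d = i := by by_contra h; exact hdp (hp d h)
    set d1 := Q.next d with hd1
    set d2 := Q.next d1 with hd2
    set d3 := Q.next d2 with hd3
    have hb1 : d1.fst ∈ Q.black := (Q.next_fst_mem_black_iff d).2 hdb
    have hb2 : d2.fst ∉ Q.black := by rw [hd2, Q.next_fst_mem_black_iff]; exact not_not.2 hb1
    have hb3 : d3.fst ∈ Q.black := (Q.next_fst_mem_black_iff d2).2 hb2
    have h2 : p d2.fst ↔ p d2.snd := hp d2 (by rw [← hdi]; exact hc.next_next_ne hdb)
    have e1 : d.snd = d1.fst := (Q.next_fst d).symm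
    have e2 : d1.snd = d2.fst := (Q.next_fst d1).symm
    have e3 : d2.snd = d3.fst := (Q.next_fst d2).symm
    have e4 : d3.snd = d.fst := by rw [← Q.next_fst d3, hd3, Q.next_next_next_next]
    have t1 : Q.turnDart d1 = d.symm := turnDart_next hdb
    have t3 : Q.turnDart d3.symm = d := by
      rw [turnDart_symm_black hb3, Q.next_next_next_next]
    by_cases hx : p d1.fst ↔ p d1.snd
    · have hx3 : ¬ (p d3.fst ↔ p d3.snd) := by
        rw [e1] at hdp; rw [e2] at hx; rw [e3] at h2; rw [e4]; tauto
      have hc3 : c d3 = i := by by_contra h; exact hx3 (hp d3 h)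
      refine ⟨d3.symm, ⟨d3.symm, ?_, ?_, ?_⟩, ?_⟩
      · rw [symm_fst_mem_black_iff]; exact not_not.2 hb3
      · rw [inDart_of_eq]; rw [t3, hc.symm, hc3, hdi]
      · intro h; exact hx3 h.symm
      · rw [turnHead, t3]
    · have hc1 : c d1 = i := by by_contra h; exact hx (hp d1 h)
      refine ⟨d1, ⟨d1.symm, ?_, ?_, ?_⟩, ?_⟩
      · rw [symm_fst_mem_black_iff]; exact not_not.2 hb1
      · rw [hc.inDart_symm, inDart_of_eq]; rw [t1, hc.symm, hc1, hdi]
      · intro h; exact hx h.symm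
      · rw [turnHead, t1, hc.inDart_symm]
  by_cases hb : d.fst ∈ Q.black
  · refine N.toFinite.isPeriodicPt_of_subset_image hN ⟨d.symm, ?_, ?_, fun h => hd h.symm⟩
    · rw [symm_fst_mem_black_iff]; exact not_not.2 hb
    · rw [hc.inDart_symm]
  · exact N.toFinite.isPeriodicPt_of_subset_image hN ⟨d, hb, rfl, hd⟩

/-- A cut edge lies on a cycle of `turnHead` by `periodic_of_change`, and leads to `s i` because all
faces around its tail do; so its head is `s i`. -/
theorem snd_eq_special_of_change [Finite V] {i j : Fin 2} (hij : i ≠ j) {e : Q.Dart}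
    (hei : e.fst = s i) (hib : s i ∈ Q.black)
    {e' : Q.Dart} (hej : e'.fst = s j) (hee : Q.rightFace e = Q.rightFace e') {d : Q.Dart}
    (hd : d.fst ∈ reaching c j (s j)) (hd' : d.snd ∉ reaching c j (s j)) : d.snd = s i := by
  have hcol : ∀ {d : Q.Dart}, c d ≠ j → c d = i := fun h => Fin.eq_of_ne_of_ne_two h hij
  have hface : ∀ d, FaceTurnsTo c i (s i) (Q.next d) ↔ FaceTurnsTo c i (s i) d := fun d =>
    faceTurnsTo_congr (Q.rightFace_next d)
  -- The face shared by `s i` and `s j` has a white dart ending at `s i`; its edge already has its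
  -- head there.
  have hye : FaceTurnsTo c i (s i) e' := by
    have hrot : (Q.rot e).fst = s i := (Q.rot_fst e).trans hei
    have hcr := hc.special i _ hrot
    refine ⟨(Q.rot e).symm, ?_, ?_, ?_, 0, ?_⟩
    · rw [← hee, ← Q.nextSymm_eq, ← Q.rightFace_next (Q.next.symm e), Equiv.apply_symm_apply]
    · rw [symm_fst_mem_black_iff, hrot]; exact not_not.2 hib
    · rw [hc.symm, hcr]
    · rw [hc.inDart_symm, inDart_of_eq, Function.iterate_zero_apply, hrot]
      rw [hcr, hc.special i _ ((turnDart_fst _).trans hrot)]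
  have hyd := hc.forall_of_mem_reaching (FaceTurnsTo c i (s i)) hface
    (fun d h => hc.faceTurnsTo_symm (hcol h)) hej hye hd d rfl
  have hcd : c d = i := by
    apply hcol
    intro h
    exact hd' ((hc.mem_reaching_iff h).1 hd)
  have hT : TurnsTo c (s i) (inDart c d) := by
    by_cases hb : d.fst ∈ Q.black
    · rw [← hc.inDart_symm, ← hc.faceTurnsTo_iff_of_white (i := i), hc.faceTurnsTo_symm hcd]
      · exact hyd
      · rw [symm_fst_mem_black_iff]; exact not_not.2 hb
      · rw [hc.symm, hcd]
    · exact (hc.faceTurnsTo_iff_of_white hb hcd).1 hyd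
  obtain ⟨m, hm⟩ := hT
  obtain ⟨n, hn, hper⟩ := hc.periodic_of_change (i := i) (· ∈ reaching c j (s j))
    (fun d h => hc.mem_reaching_iff (Fin.eq_of_ne_of_ne_two h hij.symm)) (d := d) (by tauto)
  have hfst : (inDart c d).fst = s i :=
    Function.mem_of_isPeriodicPt_of_iterate_mem (Z := {x : Q.Dart | x.fst = s i})
      (fun x hx => hc.turnHead_fst_of_special hx) hn hper hm
  by_cases h1 : c (Q.turnDart d) = c d
  · rw [inDart_of_eq h1] at hfst
    rw [hfst] at hd
    rcases Relation.ReflTransGen.cases_head hd with heq | ⟨w, ⟨e, he, hef, rfl⟩, hw⟩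
    · have h2 := hc.special j d (hfst.trans heq)
      exact absurd (hcd.symm.trans h2) hij
    · exact absurd hef (hc.fst_ne_of_mem he i)
  · rw [inDart_of_ne h1] at hfst
    exact hfst

/-- Every vertex other than `s i` has a directed path to `s j` in the other colour `j`. -/
theorem mem_reaching [Finite V] {i j : Fin 2} (hij : i ≠ j) (hs : s i ≠ s j)
    (hblack : ∀ k, s k ∈ Q.black) (houter : ∀ k, Q.OnFace (s k) Q.outer) {v : V}
    (hv : v ≠ s i) : v ∈ reaching c j (s j) := by
  obtain ⟨e, hei, heo⟩ := houter i
  obtain ⟨e', hej, heo'⟩ := houter j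
  have hee : Q.rightFace e = Q.rightFace e' := heo.trans heo'.symm
  have hstep : ∀ d : Q.Dart, d.fst ∈ reaching c j (s j) → d.snd ≠ s i →
      d.snd ∈ reaching c j (s j) := by
    intro d hd hne
    by_contra h
    exact hne (hc.snd_eq_special_of_change hij hei (hblack i) hej hee hd h)
  have hj : s j ∈ reaching c j (s j) := Relation.ReflTransGen.refl
  have hne : ∀ d : Q.Dart, d.fst = s i → d.snd ≠ s i := fun d h h' =>
    d.adj.ne (h.trans h'.symm)
  have he : e.snd ∈ reaching c j (s j) := by
    have he' : e' = Q.next (Q.next e) := by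
      have hb := hblack j
      have hb' := hblack i
      rw [← hei] at hb'
      rw [← hej] at hb
      rcases Q.rightFace_eq_cases hee with rfl | rfl | rfl | rfl
      · exact absurd (hei.symm.trans hej) hs
      · rw [Q.next_fst_mem_black_iff] at hb; exact absurd hb' hb
      · rfl
      · simp only [Q.next_fst_mem_black_iff] at hb; tauto
    have h1 := hstep (Q.next e).symm
    have h2 : (Q.next e).symm.fst = s j := by
      rw [← hej, he', Q.next_fst (Q.next e)]; rfl
    have h3 : (Q.next e).symm.snd = e.snd := Q.next_fst e
    rw [h2, h3] at h1
    exact h1 hj (hne e hei)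
  -- Consecutive neighbours of `s i` are joined through the opposite vertex of their common face,
  -- avoiding `s i`. So all neighbours are reached once one is.
  have hnbr : ∀ d : Q.Dart, d.fst = s i → d.snd ∈ reaching c j (s j) := by
    intro d hd
    refine Q.rot_induction (P := fun d => d.snd ∈ reaching c j (s j)) (d := e)
      (hei.trans hd.symm) (fun x hx hxr => ?_) he
    have hxi := hx.trans hei
    have h1 : (Q.next x).snd ∈ reaching c j (s j) := by
      apply hstep
      · rw [Q.next_fst]; exact hxr
      · rw [← Q.next_fst, ← hxi]
        exact (Q.fst_ne_next_next_fst x).symm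
    have h2 : (Q.next (Q.next x)).snd ∈ reaching c j (s j) := by
      apply hstep
      · rw [Q.next_fst]; exact h1
      · rw [← Q.next_fst]
        have h3 : (Q.rot x).snd = (Q.next (Q.next (Q.next x))).fst := by
          rw [Q.rot_eq_symm_next]; rfl
        rw [← h3]
        exact hne _ ((Q.rot_fst x).trans hxi)
    rw [Q.rot_eq_symm_next]
    change (Q.next (Q.next (Q.next x))).fst ∈ _
    rw [Q.next_fst]
    exact h2
  obtain ⟨w⟩ := Q.connected.preconnected (s j) v
  have hwalk : ∀ u v, (u ∈ reaching c j (s j) ∨ u = s i) → Q.graph.Walk u v →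
      (v ∈ reaching c j (s j) ∨ v = s i) := by
    intro u v hu w
    induction w with
    | nil => exact hu
    | @cons u x _ h w ih =>
      refine ih ?_
      by_cases hi : x = s i
      · exact Or.inr hi
      · rcases hu with hu | rfl
        · exact Or.inl (hstep ⟨(u, x), h⟩ hu hi)
        · exact Or.inl (hnbr ⟨(_, x), h⟩ rfl)
  exact (hwalk _ _ (Or.inl hj) w).resolve_right hv

end IsColouring
end Quadrangulation

/-! ### Cyclic intervals under reversal and shift -/

theorem IsCyclicInterval.symm {α : Type*} {p : Equiv.Perm α} {S : Set α}
    (h : IsCyclicInterval p S) : IsCyclicInterval p.symm S := by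
  obtain ⟨a, k, hk, rfl⟩ := h
  have key : ∀ j m, j ≤ m → (p.symm ^ j) ((p ^ m) a) = (p ^ (m - j)) a := by
    intro j m hjm
    rw [← Equiv.Perm.inv_def, inv_pow, Equiv.Perm.inv_eq_iff_eq, ← Equiv.Perm.mul_apply, ← pow_add,
      Nat.add_sub_cancel' hjm]
  refine ⟨(p ^ (k - 1)) a, k, hk, Set.ext fun x => ⟨?_, ?_⟩⟩
  · rintro ⟨j, hj, rfl⟩
    refine ⟨k - 1 - j, by omega, ?_⟩
    rw [key _ _ (by omega), show k - 1 - (k - 1 - j) = j by omega]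
  · rintro ⟨j, hj, rfl⟩
    exact ⟨k - 1 - j, by omega, key _ _ (by omega)⟩

theorem IsCyclicInterval.preimage {α : Type*} {p q : Equiv.Perm α} {S : Set α}
    (h : IsCyclicInterval p S) (hpq : Commute q p) : IsCyclicInterval p (q ⁻¹' S) := by
  obtain ⟨a, k, hk, rfl⟩ := h
  refine ⟨q.symm a, k, hk, Set.ext fun x => ?_⟩
  refine exists_congr fun j => and_congr_right fun _ => ?_
  have h1 : (p ^ j) (q.symm a) = q.symm ((p ^ j) a) := by
    have := (hpq.inv_left.pow_right j).eq
    exact (Equiv.congr_fun this a).symm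
  rw [h1, Equiv.eq_symm_apply]

/-! ### From colourings to separating decompositions -/

namespace Quadrangulation

variable {V : Type*} {Q : Quadrangulation V} {s : Fin 2 → V} {c : Q.Dart → Fin 2}

namespace IsColouring

variable (hc : Q.IsColouring s c)
include hc

theorem isDirectedTree [Finite V] {i j : Fin 2} (hij : i ≠ j) (hs : s i ≠ s j)
    (hblack : ∀ k, s k ∈ Q.black) (houter : ∀ k, Q.OnFace (s k) Q.outer) :
    IsDirectedTree (directedEdges c j) (s j) := by
  let H : Q.graph.Subgraph :=
    { verts := {v | v = s j ∨ ∃ d ∈ directedEdges c j, d.fst = v ∨ d.snd = v}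
      Adj := fun u v => ∃ d ∈ directedEdges c j, d.edge = s(u, v)
      adj_sub := by
        rintro u v ⟨d, -, h⟩
        rw [← SimpleGraph.mem_edgeSet, ← h]
        exact d.edge_mem
      edge_vert := by
        rintro u v ⟨d, hd, h⟩
        refine Or.inr ⟨d, hd, ?_⟩
        rcases SimpleGraph.dart_edge_eq_mk'_iff'.1 h with h | h
        · exact Or.inl h.1
        · exact Or.inr h.2
      symm := ⟨fun u v ⟨d, hd, h⟩ => ⟨d, hd, h.trans Sym2.eq_swap⟩⟩ }
  have hreach : ∀ v ∈ H.verts, v ∈ reaching c j (s j) := by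
    intro v hv
    refine hc.mem_reaching hij hs hblack houter ?_
    rintro rfl
    rcases hv with h | ⟨d, hd, h | h⟩
    · exact hs h
    · exact hc.fst_ne_of_mem hd i h
    · have := hc.special i d.symm h
      rw [hc.symm, hd.1] at this
      exact hij this.symm
  have hroot : s j ∈ H.verts := Or.inl rfl
  have hconn : ∀ v, v ∈ reaching c j (s j) → ∀ hv : v ∈ H.verts,
      H.coe.Reachable ⟨v, hv⟩ ⟨s j, hroot⟩ := by
    intro v h
    induction h using Relation.ReflTransGen.head_induction_on with
    | refl => exact fun _ => SimpleGraph.Reachable.refl _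
    | head h _ ih =>
      obtain ⟨d, hd, rfl, rfl⟩ := h
      intro hv
      have hadj : H.Adj d.fst d.snd := ⟨d, hd, rfl⟩
      exact (SimpleGraph.Adj.reachable (G := H.coe) (u := ⟨d.fst, hv⟩) 
        (v := ⟨d.snd, H.edge_vert hadj.symm⟩)
        hadj).trans (ih _)
  have hconn' : H.coe.Connected :=
    { preconnected := fun u v =>
        (hconn u (hreach u u.2) u.2).trans (hconn v (hreach v v.2) v.2).symm
      nonempty := ⟨⟨s j, hroot⟩⟩ }
  refine ⟨H, rfl, fun _ _ => Iff.rfl, ?_, hreach⟩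
  rw [SimpleGraph.isTree_iff_connected_and_card]
  refine ⟨hconn', le_antisymm ?_ hconn'.card_vert_le_card_edgeSet_add_one⟩
  have hex : ∀ e : H.coe.edgeSet, ∃ d ∈ directedEdges c j, d.edge = e.1.map Subtype.val := by
    rintro ⟨e, he⟩
    induction e using Sym2.ind with
    | _ u v => exact he
  choose g hg hge using hex
  -- Sending an edge to its tail is injective and misses the root, so there are fewer edges than
  -- vertices; with connectedness this gives a tree.
  let f : H.coe.edgeSet → H.verts := fun e => ⟨(g e).fst, Or.inr ⟨g e, hg e, Or.inl rfl⟩⟩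
  have hf : Function.Injective f := by
    intro e e' h
    have h1 : g e = g e' := hc.eq_of_mem_of_fst_eq (hg e) (hg e') (congrArg Subtype.val h)
    apply Subtype.ext
    apply Sym2.map.injective Subtype.val_injective
    rw [← hge, ← hge, h1]
  have hnot : (⟨s j, hroot⟩ : H.verts) ∉ Set.range f := by
    rintro ⟨e, he⟩
    exact hc.fst_ne_of_mem (hg e) j (congrArg Subtype.val he)
  have := Fintype.ofFinite H.coe.edgeSet
  have := Fintype.ofFinite H.verts
  rw [Nat.card_eq_fintype_card, Nat.card_eq_fintype_card]
  exact Fintype.card_lt_of_injective_of_notMem f hf hnot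

theorem symm_notMem {d : Q.Dart} {i : Fin 2} (h : d ∈ directedEdges c i) :
    d.symm ∉ directedEdges c i := by
  rw [hc.mem_directedEdges] at h
  rw [hc.symm_mem_directedEdges]
  tauto

theorem partition (e : Sym2 V) (he : e ∈ Q.graph.edgeSet) :
    ∃! p : Fin 2 × Q.Dart, p.2.edge = e ∧ p.2 ∈ directedEdges c p.1 := by
  have key : ∀ d : Q.Dart, d.edge = e → d ∈ directedEdges c (c d) →
      ∃! p : Fin 2 × Q.Dart, p.2.edge = e ∧ p.2 ∈ directedEdges c p.1 := by
    intro d hde hd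
    refine ⟨(c d, d), ⟨hde, hd⟩, ?_⟩
    rintro ⟨k, x⟩ ⟨hx, hxk⟩
    rcases SimpleGraph.dart_edge_eq_iff x d |>.1 (hx.trans hde.symm) with rfl | rfl
    · rw [hxk.1]
    · have hk := hxk.1
      rw [hc.symm] at hk
      rw [← hk] at hxk
      exact absurd hxk (hc.symm_notMem hd)
  induction e using Sym2.ind with
  | _ u v =>
    let d : Q.Dart := ⟨(u, v), he⟩
    rcases hc.mem_or_symm_mem (d := d) rfl with h | h
    · exact key d rfl h
    · exact key d.symm (SimpleGraph.Dart.edge_symm d) (by rwa [hc.symm])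

theorem separating [Finite V] (v : V) (hv : ∀ i, v ≠ s i) :
    ∃ (e : Q.Dart) (a b : ℕ), e.fst = v ∧
    a + 1 + b + 1 = Nat.card (Q.graph.neighborSet v) ∧
    (∀ j < a, ((Q.turn v ^ j) e).symm ∈ directedEdges c 0) ∧
    (Q.turn v ^ a) e ∈ directedEdges c 0 ∧
    (∀ j < b, ((Q.turn v ^ (a + 1 + j)) e).symm ∈ directedEdges c 1) ∧
    (Q.turn v ^ (a + 1 + b)) e ∈ directedEdges c 1 := by
  obtain ⟨e, a, b, rfl, hn, h0, h1⟩ := hc.vertex v hv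
  obtain ⟨-, hper, -, -⟩ := Q.turn_enum e.fst e
  rw [← hn] at hper
  refine ⟨e, a, b, rfl, hn, fun j hj => ?_, ?_, fun j hj => ?_, ?_⟩
  · rw [hc.symm_mem_directedEdges, ← turn_pow_succ rfl]
    exact ⟨h0 j hj.le, h0 (j + 1) hj⟩
  · rw [hc.mem_directedEdges, ← turn_pow_succ rfl]
    exact ⟨h0 a le_rfl, by rw [show a + 1 = a + 1 + 0 from rfl, h1 0 (Nat.zero_le _)]; decide⟩
  · rw [hc.symm_mem_directedEdges, ← turn_pow_succ rfl, add_assoc (a + 1)]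
    exact ⟨h1 j hj.le, h1 (j + 1) hj⟩
  · rw [hc.mem_directedEdges, ← turn_pow_succ rfl, hper]
    refine ⟨h1 b le_rfl, ?_⟩
    have := h0 0 (Nat.zero_le _)
    rw [pow_zero, Equiv.Perm.one_apply] at this
    rw [this]; decide

end IsColouring

/-- The separating decomposition of a colouring. -/
def IsColouring.decomposition [Finite V] (hc : Q.IsColouring s c) (hs : s 0 ≠ s 1)
    (hblack : ∀ k, s k ∈ Q.black) (houter : ∀ k, Q.OnFace (s k) Q.outer) :
    Q.SeparatingDecomposition s where
  T := directedEdges c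
  partition := hc.partition
  tree := Fin.forall_fin_two.2 ⟨hc.isDirectedTree (i := 1) (by decide) hs.symm hblack houter,
    hc.isDirectedTree (i := 0) (by decide) hs hblack houter⟩
  separating := hc.separating

/-! ### From separating decompositions to colourings -/

namespace SeparatingDecomposition

variable (S : Q.SeparatingDecomposition s)

theorem eq_of_edge_eq {x y : Q.Dart} {i k : Fin 2} (hx : x ∈ S.T i) (hy : y ∈ S.T k)
    (h : x.edge = y.edge) : x = y ∧ i = k := by
  have := (S.partition y.edge y.edge_mem).unique (y₁ := (i, x)) (y₂ := (k, y)) ⟨h, hx⟩ ⟨rfl, hy⟩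
  exact ⟨congrArg Prod.snd this, congrArg Prod.fst this⟩

theorem symm_notMem {x : Q.Dart} {i k : Fin 2} (hx : x ∈ S.T i) : x.symm ∉ S.T k := fun h =>
  x.symm_ne (S.eq_of_edge_eq hx h (SimpleGraph.Dart.edge_symm x).symm).1.symm

theorem exists_mem (d : Q.Dart) : ∃ i, d ∈ S.T i ∨ d.symm ∈ S.T i := by
  obtain ⟨⟨i, x⟩, ⟨hx, hxi⟩, -⟩ := S.partition d.edge d.edge_mem
  rcases SimpleGraph.dart_edge_eq_iff x d |>.1 hx with rfl | rfl
  · exact ⟨i, Or.inl hxi⟩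
  · exact ⟨i, Or.inr hxi⟩

theorem exists_out {v : V} (hv : ∀ i, v ≠ s i) (i : Fin 2) : ∃ x ∈ S.T i, x.fst = v := by
  obtain ⟨e, a, b, he, -, -, h0, -, h1⟩ := S.separating v hv
  rcases Fin.exists_fin_two.1 ⟨i, rfl⟩ with rfl | rfl
  · exact ⟨_, h0, (Q.turn_pow_fst _ _ _).trans he⟩
  · exact ⟨_, h1, (Q.turn_pow_fst _ _ _).trans he⟩

/-- By Euler's formula, no edge leaves a special vertex. -/
theorem fst_ne [Finite V] (hs : s 0 ≠ s 1) {x : Q.Dart} {i : Fin 2} (hx : x ∈ S.T i)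
    (k : Fin 2) : x.fst ≠ s k := by
  have hex : ∀ p : {v : V // ∀ i, v ≠ s i} × Fin 2, ∃ x ∈ S.T p.2, x.fst = p.1 :=
    fun p => S.exists_out p.1.2 p.2
  choose o ho hof using hex
  let f : {v : V // ∀ i, v ≠ s i} × Fin 2 → Q.graph.edgeSet := fun p => ⟨(o p).edge, (o p).edge_mem⟩
  have hf : Function.Injective f := by
    intro p q h
    obtain ⟨h1, h2⟩ := S.eq_of_edge_eq (ho p) (ho q) (congrArg Subtype.val h)
    refine Prod.ext (Subtype.ext ?_) h2
    rw [← hof, ← hof, h1]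
  have hcard : Nat.card {v : V // ∀ i, v ≠ s i} + 2 = Nat.card V := by
    have h1 : {v : V | ∀ i, v ≠ s i} = ({s 0, s 1} : Set V)ᶜ := by
      ext v
      simp [Fin.forall_fin_two]
    have h2 := Set.ncard_add_ncard_compl ({s 0, s 1} : Set V)
    rw [Set.ncard_pair hs, ← h1] at h2
    rw [← h2, add_comm]
    rfl
  have hE := Q.card_edgeSet
  -- The 2(n - 2) out-edges of ordinary vertices exhaust all 2n - 4 edges.
  have hb := hf.bijective_of_nat_card_le (by
    rw [Nat.card_prod, Nat.card_fin]
    omega)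
  obtain ⟨p, hp⟩ := hb.2 ⟨x.edge, x.edge_mem⟩
  obtain ⟨h1, -⟩ := S.eq_of_edge_eq hx (ho p) (congrArg Subtype.val hp).symm
  rw [h1, hof]
  exact p.1.2 k

theorem exists_isColouring [Finite V] (hs : s 0 ≠ s 1) :
    ∃ c : Q.Dart → Fin 2, Q.IsColouring s c ∧ directedEdges c = S.T := by
  choose c hc using S.exists_mem
  have hcT : ∀ {d i}, d ∈ S.T i → c d = i := by
    intro d i hd
    rcases hc d with h | h
    · exact (S.eq_of_edge_eq h hd rfl).2
    · exact absurd h (S.symm_notMem hd)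
  have hcT' : ∀ {d i}, d.symm ∈ S.T i → c d = i := by
    intro d i hd
    rcases hc d with h | h
    · exact absurd hd (S.symm_notMem h)
    · exact (S.eq_of_edge_eq h hd rfl).2
  have hsymm : ∀ d, c d.symm = c d := by
    intro d
    rcases hc d with h | h
    · exact hcT' (by rwa [SimpleGraph.Dart.symm_symm])
    · exact hcT h
  have hinj : ∀ i k, s i = s k → i = k := by
    intro i k h
    by_contra hne
    obtain ⟨rfl, rfl⟩ | ⟨rfl, rfl⟩ : (i = 0 ∧ k = 1) ∨ (i = 1 ∧ k = 0) := by omega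
    · exact hs h
    · exact hs h.symm
  -- Every edge at `s i` enters it, so `s i` lies in the tree of that edge. With no way out, it must
  -- be the sink of that tree.
  have hspecial : ∀ (i : Fin 2) (d : Q.Dart), d.fst = s i → c d = i := by
    intro i d hd
    have h := (hc d).resolve_left fun h => S.fst_ne hs h i hd
    obtain ⟨H, hverts, -, -, hpath⟩ := S.tree (c d)
    have hi : s i ∈ H.verts := by
      rw [hverts]
      exact Or.inr ⟨_, h, Or.inr hd⟩
    rcases Relation.ReflTransGen.cases_head (hpath _ hi) with heq | ⟨w, ⟨e, he, hef, -⟩, -⟩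
    · exact (hinj _ _ heq).symm
    · exact absurd hef (S.fst_ne hs he i)
  have hcol : ∀ {n : ℕ} {f : ℕ → Q.Dart} {i : Fin 2}, (∀ j < n, (f j).symm ∈ S.T i) →
      f n ∈ S.T i → ∀ j ≤ n, c (f j) = i := by
    intro n f i h h' j hj
    rcases hj.lt_or_eq with hj | rfl
    · exact hcT' (h j hj)
    · exact hcT h'
  have hvertex : ∀ v, (∀ i, v ≠ s i) → ∃ (e : Q.Dart) (a b : ℕ), e.fst = v ∧
      a + 1 + b + 1 = Nat.card (Q.graph.neighborSet v) ∧
      (∀ j ≤ a, c ((Q.turn v ^ j) e) = 0) ∧ (∀ j ≤ b, c ((Q.turn v ^ (a + 1 + j)) e) = 1) := by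
    intro v hv
    obtain ⟨e, a, b, he, hn, h0, h0', h1, h1'⟩ := S.separating v hv
    exact ⟨e, a, b, he, hn, hcol h0 h0', hcol h1 h1'⟩
  have hturn : ∀ x, c (Q.turnDart x) = c x ↔ x.symm ∈ S.T (c x) := by
    intro x
    by_cases hx : ∃ i, x.fst = s i
    · obtain ⟨i, hi⟩ := hx
      have := (hc x).resolve_left fun h => S.fst_ne hs h i hi
      rw [hspecial i _ ((turnDart_fst x).trans hi), hspecial i x hi] at *
      tauto
    · push Not at hx
      obtain ⟨e, a, b, he, hn, h0, h0', h1, h1'⟩ := S.separating x.fst hx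
      obtain ⟨-, hper, hsurj, -⟩ := Q.turn_enum x.fst e
      obtain ⟨j, hj, hxj⟩ := hsurj x he.symm
      have hnext : Q.turnDart x = (Q.turn x.fst ^ (j + 1)) e := by
        rw [turn_pow_succ he, ← hxj]
      rw [he, ← hn] at hj hper
      have c0 := hcol h0 h0'
      have c1 := hcol (f := fun j => (Q.turn x.fst ^ (a + 1 + j)) e) h1 h1'
      rcases lt_trichotomy j a with hja | rfl | hja
      · have hm := h0 j hja
        rw [← hxj] at hm
        have e1 : c x = 0 := hcT' hm
        rw [hnext, c0 (j + 1) hja, e1]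
        exact iff_of_true rfl hm
      · rw [← hxj] at h0'
        have e1 : c (Q.turnDart x) = 1 := by rw [hnext]; exact c1 0 (Nat.zero_le _)
        rw [e1, hcT h0']
        exact iff_of_false (by decide) (S.symm_notMem h0')
      · obtain ⟨k, rfl⟩ := Nat.exists_eq_add_of_lt hja
        rw [show a + k + 1 = a + 1 + k by ring] at hj hxj hnext
        rcases (show k ≤ b by omega).lt_or_eq with hk | rfl
        · have hm := h1 k hk
          rw [← hxj] at hm
          have e1 : c (Q.turnDart x) = 1 := by rw [hnext, add_assoc]; exact c1 (k + 1) hk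
          rw [e1, hcT' hm]
          exact iff_of_true rfl hm
        · rw [← hxj] at h1'
          have e1 : c (Q.turnDart x) = 0 := by
            rw [hnext, hper]; exact c0 0 (Nat.zero_le _)
          rw [e1, hcT h1']
          exact iff_of_false (by decide) (S.symm_notMem h1')
  refine ⟨c, ⟨hsymm, fun d => ?_, hspecial, hvertex⟩, ?_⟩
  · rw [hturn, ← hsymm d, ← not_iff_not, Ne, not_not, hturn, SimpleGraph.Dart.symm_symm, hsymm]
    rcases hc d with h | h
    · exact ⟨fun _ => h, fun _ => S.symm_notMem h⟩
    · exact ⟨fun h' => absurd h h', fun h' => absurd h (S.symm_notMem h')⟩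
  · funext i
    ext d
    change c d = i ∧ c (Q.turnDart d.symm) = i ↔ _
    constructor
    · rintro ⟨rfl, h2⟩
      rw [← hsymm d, hturn, SimpleGraph.Dart.symm_symm, hsymm] at h2
      exact h2
    · intro h
      have h1 := hcT h
      refine ⟨h1, ?_⟩
      have := (hturn d.symm).2 (by rwa [SimpleGraph.Dart.symm_symm, hsymm, h1])
      rw [this, hsymm, h1]

end SeparatingDecomposition
end Quadrangulation

/-! ### Labels of angles versus colours of edges -/

namespace Quadrangulation

variable {V : Type*} {Q : Quadrangulation V} {s : Fin 2 → V}

open Classical in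
/-- The colours of the edges given by a labeling of the angles. -/
noncomputable def edgeColour (label : Q.Dart → Fin 2) (d : Q.Dart) : Fin 2 :=
  if d.fst ∈ Q.black then label (Q.rot.symm d) else label d

open Classical in
/-- The labels of the angles given by a colouring of the edges. -/
noncomputable def angleLabel (c : Q.Dart → Fin 2) (d : Q.Dart) : Fin 2 :=
  if d.fst ∈ Q.black then c (Q.rot d) else c d

theorem edgeColour_angleLabel (c : Q.Dart → Fin 2) : edgeColour (angleLabel c) = c := by
  funext d
  by_cases h : d.fst ∈ Q.black
  · rw [edgeColour, if_pos h, angleLabel, if_pos (by rwa [Q.rot_symm_fst]),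
      Equiv.apply_symm_apply]
  · rw [edgeColour, if_neg h, angleLabel, if_neg h]

theorem angleLabel_edgeColour (label : Q.Dart → Fin 2) : angleLabel (edgeColour label) = label := by
  funext d
  by_cases h : d.fst ∈ Q.black
  · rw [angleLabel, if_pos h, edgeColour, if_pos (by rwa [Q.rot_fst]),
      Equiv.symm_apply_apply]
  · rw [angleLabel, if_neg h, edgeColour, if_neg h]

/-- The colours of an edge and of the next edge are the labels on both sides of the edge. -/
theorem edgeColour_turnDart (label : Q.Dart → Fin 2) (d : Q.Dart) :
    (edgeColour label d = label d ∧
      edgeColour label (Q.turnDart d) = label (Q.rot.symm d)) ∨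
    (edgeColour label d = label (Q.rot.symm d) ∧
      edgeColour label (Q.turnDart d) = label d) := by
  by_cases h : d.fst ∈ Q.black
  · right
    rw [turnDart_black h, edgeColour, edgeColour, if_pos h, if_pos (by rwa [Q.rot_fst]),
      Equiv.symm_apply_apply]
    exact ⟨rfl, rfl⟩
  · left
    rw [turnDart_white h, edgeColour, edgeColour, if_neg h, if_neg (by rwa [Q.rot_symm_fst])]
    exact ⟨rfl, rfl⟩

theorem edgeColour_turnDart_eq_iff (label : Q.Dart → Fin 2) (d : Q.Dart) :
    edgeColour label (Q.turnDart d) = edgeColour label d ↔ label (Q.rot.symm d) = label d := by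
  rcases edgeColour_turnDart label d with ⟨h, h'⟩ | ⟨h, h'⟩ <;> rw [h, h']
  exact eq_comm

/-- At a black vertex the two sets differ by one step of `rot`; at a white vertex they coincide and
only the direction of turning is reversed. -/
theorem isCyclicInterval_edgeColour_iff (label : Q.Dart → Fin 2) (v : V) (i : Fin 2) :
    IsCyclicInterval (Q.turn v) {d : Q.Dart | d.fst = v ∧ edgeColour label d = i} ↔
      IsCyclicInterval Q.rot {d : Q.Dart | d.fst = v ∧ label d = i} := by
  by_cases h : v ∈ Q.black
  · rw [Q.turn_black h]
    have h1 : {d : Q.Dart | d.fst = v ∧ edgeColour label d = i} =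
        (Q.rot⁻¹ : Equiv.Perm Q.Dart) ⁻¹' {d : Q.Dart | d.fst = v ∧ label d = i} := by
      ext d
      change _ ↔ (Q.rot.symm d).fst = v ∧ label (Q.rot.symm d) = i
      rw [Q.rot_symm_fst]
      exact and_congr_right fun hd => by rw [edgeColour, if_pos (by rwa [hd])]
    have h2 : {d : Q.Dart | d.fst = v ∧ label d = i} =
        Q.rot ⁻¹' {d : Q.Dart | d.fst = v ∧ edgeColour label d = i} := by
      rw [h1, ← Set.preimage_comp]
      ext d
      simp
    constructor
    · intro hi
      rw [h2]
      exact hi.preimage (Commute.refl _)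
    · intro hi
      rw [h1]
      exact hi.preimage (Commute.refl _).inv_left
  · rw [Q.turn_white h]
    have h1 : {d : Q.Dart | d.fst = v ∧ edgeColour label d = i} =
        {d : Q.Dart | d.fst = v ∧ label d = i} := by
      ext d
      exact and_congr_right fun hd => by rw [edgeColour, if_neg (by rwa [hd])]
    rw [h1]
    exact ⟨fun hi => hi.symm, fun hi => hi.symm⟩

namespace IsColouring

variable {c : Q.Dart → Fin 2} (hc : Q.IsColouring s c)
include hc

theorem isCyclicInterval [Finite V] {v : V} (hv : ∀ i, v ≠ s i) (i : Fin 2) :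
    IsCyclicInterval (Q.turn v) {d : Q.Dart | d.fst = v ∧ c d = i} := by
  obtain ⟨e, a, b, rfl, hn, h0, h1⟩ := hc.vertex v hv
  obtain ⟨-, -, hsurj, -⟩ := Q.turn_enum e.fst e
  rw [← hn] at hsurj
  have h1' : ∀ j, a < j → j < a + 1 + b + 1 → c ((Q.turn e.fst ^ j) e) = 1 := by
    intro j hj hj'
    obtain ⟨k, rfl⟩ := Nat.exists_eq_add_of_lt hj
    rw [show a + k + 1 = a + 1 + k by ring]
    exact h1 k (by omega)
  rcases Fin.exists_fin_two.1 ⟨i, rfl⟩ with rfl | rfl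
  · refine ⟨e, a + 1, by omega, Set.ext fun d => ⟨?_, ?_⟩⟩
    · rintro ⟨hd, hd0⟩
      obtain ⟨j, hj, rfl⟩ := hsurj d hd
      refine ⟨j, ?_, rfl⟩
      by_contra h
      rw [h1' j (by omega) hj] at hd0
      exact absurd hd0 (by decide)
    · rintro ⟨j, hj, rfl⟩
      exact ⟨Q.turn_pow_fst _ _ _, h0 j (by omega)⟩
  · refine ⟨(Q.turn e.fst ^ (a + 1)) e, b + 1, by omega, Set.ext fun d => ⟨?_, ?_⟩⟩
    · rintro ⟨hd, hd1⟩
      obtain ⟨j, hj, rfl⟩ := hsurj d hd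
      have hja : a + 1 ≤ j := by
        by_contra h
        rw [h0 j (by omega)] at hd1
        exact absurd hd1 (by decide)
      refine ⟨j - (a + 1), by omega, ?_⟩
      rw [← Equiv.Perm.mul_apply, ← pow_add, Nat.sub_add_cancel hja]
    · rintro ⟨j, hj, rfl⟩
      rw [← Equiv.Perm.mul_apply, ← pow_add]
      exact ⟨Q.turn_pow_fst _ _ _, h1' _ (by omega) (by omega)⟩

/-- From a white tail, both labels are the colour of `d`. From a black tail, they are the colours of
the edges following `d` at its two ends, exactly one of which equals the colour of `d`. -/
theorem angleLabel_next_eq_iff (d : Q.Dart) :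
    angleLabel c (Q.next d) = angleLabel c d ↔ d.fst ∉ Q.black := by
  by_cases h : d.fst ∈ Q.black
  · have hn := hc.edge d
    rw [turnDart_symm_black h, turnDart_black h] at hn
    refine iff_of_false ?_ (not_not.2 h)
    rw [angleLabel, if_neg (by rw [Q.next_fst_mem_black_iff]; exact not_not.2 h), angleLabel,
      if_pos h]
    intro h2
    rw [h2] at hn
    tauto
  · refine iff_of_true ?_ h
    rw [angleLabel, if_pos ((Q.next_fst_mem_black_iff d).2 h), angleLabel, if_neg h, Q.rot_next,
      hc.symm]

theorem eq_of_directedEdges_eq {c' : Q.Dart → Fin 2} (hc' : Q.IsColouring s c')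
    (h : directedEdges c = directedEdges c') : c = c' := by
  funext d
  rcases hc.mem_or_symm_mem (d := d) rfl with hd | hd
  · exact (h ▸ hd : d ∈ directedEdges c' (c d)).1.symm
  · rw [← hc'.symm]
    exact (h ▸ hd : d.symm ∈ directedEdges c' (c d)).1.symm

/-- The strong labeling of a colouring. -/
noncomputable def labeling [Finite V] (hblack : ∀ i, s i ∈ Q.black) : Q.StrongLabeling s where
  label := angleLabel c
  special i d hd := by
    rw [angleLabel, if_pos (by rw [hd]; exact hblack i)]
    exact hc.special i _ ((Q.rot_fst d).trans hd)
  vertex_rule v hv i := by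
    rw [← isCyclicInterval_edgeColour_iff, edgeColour_angleLabel]
    exact hc.isCyclicInterval hv i
  edge_rule d := by
    rw [← edgeColour_turnDart_eq_iff, ← edgeColour_turnDart_eq_iff, edgeColour_angleLabel,
      hc.symm d, hc.edge d]
    by_cases h : c (Q.turnDart d.symm) = c d
    · exact Or.inr ⟨h, fun h' => h' h⟩
    · exact Or.inl ⟨h, h⟩
  face_rule f := by
    obtain ⟨d, hdf, hdb⟩ : ∃ d : Q.Dart, Q.rightFace d = f ∧ d.fst ∉ Q.black := by
      obtain ⟨d, rfl⟩ := Quotient.exists_rep f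
      by_cases h : d.fst ∈ Q.black
      · exact ⟨Q.next d, Q.rightFace_next d,
          by rw [Q.next_fst_mem_black_iff]; exact not_not.2 h⟩
      · exact ⟨d, rfl, h⟩
    have hb1 : (Q.next d).fst ∈ Q.black := (Q.next_fst_mem_black_iff d).2 hdb
    have hb2 : (Q.next (Q.next d)).fst ∉ Q.black := by
      rw [Q.next_fst_mem_black_iff]; exact not_not.2 hb1
    have e0 := (hc.angleLabel_next_eq_iff d).2 hdb
    have e1 : angleLabel c (Q.next (Q.next d)) ≠ angleLabel c (Q.next d) := fun h =>
      (hc.angleLabel_next_eq_iff (Q.next d)).1 h hb1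
    have e2 := (hc.angleLabel_next_eq_iff (Q.next (Q.next d))).2 hb2
    -- From a white vertex the labels read `aabb` with `a ≠ b`; the walk starts at whichever white
    -- vertex has label `0`.
    by_cases h0 : angleLabel c d = 0
    · refine ⟨d, hdf, h0, e0.trans h0, ?_, ?_⟩
      · change angleLabel c (Q.next (Q.next d)) = 1
        omega
      · change angleLabel c (Q.next (Q.next (Q.next d))) = 1
        omega
    · refine ⟨Q.next (Q.next d), ?_, ?_, ?_, ?_, ?_⟩
      · rw [Q.rightFace_next, Q.rightFace_next, hdf]
      · omega
      · omega
      · change angleLabel c (Q.next (Q.next (Q.next (Q.next d)))) = 1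
        rw [Q.next_next_next_next]
        omega
      · change angleLabel c (Q.next (Q.next (Q.next (Q.next (Q.next d))))) = 1
        rw [Q.next_next_next_next]
        omega
  outer_rule d _ hd := by
    have hb : d.fst ∈ Q.black := by rw [hd]; exact hblack 0
    have h0 : angleLabel c d = 0 := by
      rw [angleLabel, if_pos hb]
      exact hc.special 0 _ ((Q.rot_fst d).trans hd)
    change _ ∧ _ ∧ angleLabel c (Q.next.symm (Q.next.symm d)) = 1 ∧
      angleLabel c (Q.next.symm (Q.next.symm (Q.next.symm d))) = 1
    obtain ⟨e, rfl⟩ : ∃ e, d = Q.next (Q.next (Q.next e)) :=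
      ⟨Q.next d, by rw [Q.next_next_next_next]⟩
    simp only [Equiv.symm_apply_apply]
    have e0 := hc.angleLabel_next_eq_iff e
    have e1 := hc.angleLabel_next_eq_iff (Q.next e)
    have e2 := hc.angleLabel_next_eq_iff (Q.next (Q.next e))
    simp only [Q.next_fst_mem_black_iff, not_not] at hb e1 e2
    have e0' := e0.2 hb
    have e1' : ¬ _ := fun h => hb (e1.1 h)
    have e2' := e2.2 hb
    refine ⟨h0, ?_, ?_, ?_⟩ <;> omega

end IsColouring

namespace StrongLabeling

variable (L : Q.StrongLabeling s)

theorem label_next_next_eq_iff (d : Q.Dart) :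
    L.label (Q.next (Q.next d)) = L.label (Q.next d) ↔ L.label (Q.next d) ≠ L.label d := by
  obtain ⟨e, he, h0, h1, h2, h3⟩ := L.face_rule (Q.rightFace d)
  change L.label (Q.next (Q.next e)) = 1 at h2
  change L.label (Q.next (Q.next (Q.next e))) = 1 at h3
  rcases Q.rightFace_eq_cases he with rfl | rfl | rfl | rfl <;>
    simp only [Q.next_next_next_next, h0, h1, h2, h3] <;> decide

/-- The four angles at an edge form a cycle, around which labels change an even number of times. By
the edge rule just one of the two endpoints has a change, so just one of the two sides has one. -/
theorem label_next_symm_eq_iff (d : Q.Dart) :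
    L.label (Q.next d.symm) = L.label d.symm ↔ L.label (Q.next d) ≠ L.label d := by
  have h := L.edge_rule d
  have h1 := Q.next_symm_eq d
  have h2 := Q.next_symm_eq d.symm
  rw [SimpleGraph.Dart.symm_symm] at h2
  rw [← h1, ← h2, xor_iff_not_iff] at h
  omega

/-- Both sides of the equivalence flip along a face and across an edge, so its validity spreads by
connectedness from the outer face, where `outer_rule` gives it. -/
theorem label_next_eq_iff [Finite V] (hblack : ∀ i, s i ∈ Q.black)
    (houter : ∀ i, Q.OnFace (s i) Q.outer) (d : Q.Dart) :
    L.label (Q.next d) = L.label d ↔ d.fst ∉ Q.black := by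
  let P : Q.Dart → Prop := fun d => L.label (Q.next d) = L.label d ↔ d.fst ∉ Q.black
  have hnext : ∀ d, P (Q.next d) ↔ P d := by
    intro d
    simp only [P, Q.next_fst_mem_black_iff, L.label_next_next_eq_iff]
    tauto
  have hsymm : ∀ d : Q.Dart, P d.symm ↔ P d := by
    intro d
    simp only [P, symm_fst_mem_black_iff, L.label_next_symm_eq_iff]
    tauto
  have hrot : ∀ d e : Q.Dart, d.fst = e.fst → P d → P e := by
    intro d e hde hd
    refine Q.rot_induction (P := P) hde (fun x _ hx => ?_) hd
    rw [← hsymm, ← hnext, Q.next_symm_eq, Equiv.symm_apply_apply]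
    exact hx
  have hwalk : ∀ u v, Q.graph.Walk u v → (∀ e : Q.Dart, e.fst = u → P e) →
      ∀ e : Q.Dart, e.fst = v → P e := by
    intro u v w
    induction w with
    | nil => exact id
    | @cons u x _ h w ih =>
      intro hu
      let o : Q.Dart := ⟨(u, x), h⟩
      exact ih fun e he => hrot o.symm e he.symm ((hsymm o).2 (hu o rfl))
  obtain ⟨e, he, heo⟩ := houter 0
  obtain ⟨w⟩ := Q.connected.preconnected (s 0) d.fst
  refine hwalk _ _ w (fun x hx => hrot e x (he.trans hx.symm) ?_) d rfl
  obtain ⟨h0, h1, -, -⟩ := L.outer_rule e heo he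
  rw [← Equiv.apply_symm_apply Q.next e, hnext]
  refine iff_of_true ?_ ?_
  · rw [Equiv.apply_symm_apply, h0, h1]
  · rw [← Q.next_fst_mem_black_iff, Equiv.apply_symm_apply, he]
    exact hblack 0

theorem isColouring [Finite V] (hblack : ∀ i, s i ∈ Q.black)
    (houter : ∀ i, Q.OnFace (s i) Q.outer) : Q.IsColouring s (edgeColour L.label) := by
  have hmono := L.label_next_eq_iff hblack houter
  have hsymm' : ∀ d : Q.Dart, d.fst ∉ Q.black →
      edgeColour L.label d.symm = edgeColour L.label d := by
    intro d hd
    rw [edgeColour, if_pos ((symm_fst_mem_black_iff d).2 hd), edgeColour, if_neg hd, ← Q.next_eq,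
      (hmono d).2 hd]
  have hsymm : ∀ d : Q.Dart, edgeColour L.label d.symm = edgeColour L.label d := by
    intro d
    by_cases hd : d.fst ∈ Q.black
    · have := hsymm' d.symm (by rw [symm_fst_mem_black_iff]; exact not_not.2 hd)
      rw [SimpleGraph.Dart.symm_symm] at this
      exact this.symm
    · exact hsymm' d hd
  refine ⟨hsymm, fun d => ?_, fun i d hd => ?_, fun v hv => ?_⟩
  · rw [edgeColour_turnDart_eq_iff, ← hsymm d, Ne, edgeColour_turnDart_eq_iff]
    have := L.edge_rule d
    rw [xor_iff_not_iff] at this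
    tauto
  · rw [edgeColour, if_pos (by rw [hd]; exact hblack i)]
    exact L.special i _ ((Q.rot_symm_fst d).trans hd)
  · obtain ⟨e, k, hk, h0⟩ := (isCyclicInterval_edgeColour_iff _ v 0).2 (L.vertex_rule v hv 0)
    obtain ⟨e', k', hk', h1⟩ := (isCyclicInterval_edgeColour_iff _ v 1).2 (L.vertex_rule v hv 1)
    have hmem : ∀ j < k, ((Q.turn v ^ j) e).fst = v ∧
        edgeColour L.label ((Q.turn v ^ j) e) = 0 := fun j hj =>
      h0.symm.subset ⟨j, hj, rfl⟩
    have he : e.fst = v := (hmem 0 hk).1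
    have he' : e'.fst = v ∧ edgeColour L.label e' = 1 := h1.symm.subset ⟨0, hk', rfl⟩
    obtain ⟨-, -, hsurj, hinj⟩ := Q.turn_enum v e
    rw [he] at hsurj hinj
    set n := Nat.card (Q.graph.neighborSet v)
    have hkn : k < n := by
      by_contra hkn
      obtain ⟨j, hj, rfl⟩ := hsurj e' he'.1
      rw [(hmem j (by omega)).2] at he'
      exact absurd he'.2 (by decide)
    -- Of the `n` darts at `v`, the first `k` have colour `0` and the other `n - k` colour `1`; each
    -- run counts one outgoing edge besides its incoming ones.
    refine ⟨e, k - 1, n - k - 1, he, by omega, fun j hj => (hmem j (by omega)).2, fun j hj => ?_⟩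
    by_contra h
    obtain ⟨l, hl, hle⟩ := h0.subset
      (show (Q.turn v ^ (k - 1 + 1 + j)) e ∈ _ from
        ⟨(Q.turn_pow_fst _ _ _).trans he, by omega⟩)
    have := hinj _ (by omega) _ (by omega) hle
    omega

theorem directedEdges_edgeColour [Finite V] (hblack : ∀ i, s i ∈ Q.black)
    (houter : ∀ i, Q.OnFace (s i) Q.outer) :
    directedEdges (edgeColour L.label) = Q.inducedEdges L.label := by
  funext i
  ext d
  change edgeColour L.label d = i ∧ edgeColour L.label (Q.turnDart d.symm) = i ↔
    L.label d.symm = i ∧ L.label (Q.rot.symm d.symm) = i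
  rw [← (L.isColouring hblack houter).symm d]
  rcases edgeColour_turnDart L.label d.symm with ⟨h, h'⟩ | ⟨h, h'⟩ <;> rw [h, h']
  exact and_comm

end StrongLabeling
end Quadrangulation

/-- For a finite quadrangulation whose two black vertices on the outer face are `s 0` and `s 1`,
sending a strong labeling to the induced colouring and orientation of the edges is a bijection from
strong labelings onto separating decompositions. -/
theorem mainTheorem3 {V : Type*} [Finite V] (Q : Quadrangulation V) (s : Fin 2 → V)
    (hs : s 0 ≠ s 1) (hblack : ∀ i, s i ∈ Q.black) (houter : ∀ i, Q.OnFace (s i) Q.outer) :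
    ∃ Φ : Q.StrongLabeling s ≃ Q.SeparatingDecomposition s,
      ∀ (L : Q.StrongLabeling s) (i : Fin 2), (Φ L).T i = Q.inducedEdges L.label i := by
  let F : Q.StrongLabeling s → Q.SeparatingDecomposition s := fun L =>
    (L.isColouring hblack houter).decomposition hs hblack houter
  have hF : Function.Bijective F := by
    constructor
    · intro L L' h
      have hT : Quadrangulation.directedEdges (Quadrangulation.edgeColour L.label) =
          Quadrangulation.directedEdges (Quadrangulation.edgeColour L'.label) :=
        congrArg Quadrangulation.SeparatingDecomposition.T h
      have hcol := (L.isColouring hblack houter).eq_of_directedEdges_eq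
        (L'.isColouring hblack houter) hT
      ext d
      rw [← Quadrangulation.angleLabel_edgeColour L.label, hcol,
        Quadrangulation.angleLabel_edgeColour]
    · intro S
      obtain ⟨c, hc, hcT⟩ := S.exists_isColouring hs
      refine ⟨hc.labeling hblack, Quadrangulation.SeparatingDecomposition.ext ?_⟩
      change Quadrangulation.directedEdges (Quadrangulation.edgeColour
        (Quadrangulation.angleLabel c)) = S.T
      rw [Quadrangulation.edgeColour_angleLabel, hcT]
  refine ⟨Equiv.ofBijective F hF, fun L i => ?_⟩
  change Quadrangulation.directedEdges (Quadrangulation.edgeColour L.label) i = _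
  rw [L.directedEdges_edgeColour hblack houter]
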